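/- For an integer $n\ge 0$ and $z\in\mathbb C$ let $$\mathbf H_n(z)=\sum_{m\ge 0}\frac{(-1)^m (z/2)^{2m+n+1}}{\Gamma(m+\frac32)\,\Gamma(m+n+\frac32)}$$ be the Struve function of order $n$. Throughout, $1/n!=0$ and $1/\Gamma(n+1)=0$ for integers $n<0$, any term containing such a factor is zero, and empty sums are zero. Put $$E(k,z)=\sum_{j=0}^{\lfloor k/2\rfloor}\frac{(-1)^j(z/2)^{k-1-2j}}{\Gamma(k+\frac32-j)}\sum_{i=0}^{j}\frac{(1/2)^{2i+1}}{i!\,(k-2i)!\,\Gamma(i+\frac12-j)} ,$$ and, for integers $\nu\ge1$, $$\mathbf S(\nu,z)=\frac1{\sqrt\pi}\sum_{j=0}^{\nu-2}\frac{(z/2)^{\nu-1-j}}{\Gamma(\nu+\frac12-j)}\,C_j(\nu,z),$$ where $C_0(\nu,z)=1$, $C_1(\nu,z)=\frac{2(\nu-1)}z$, $C_n(\nu,z)=\frac{2(\nu-n)}z C_{n-1}(\nu,z)-C_{n-2}(\nu,z)$. The function $\mathbf H_1(z)/z$ is analytic on $\mathbb C\setminus\{0\}$, and the following hold for all complex $z\neq0$.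 (i) For every integer $k\ge1$, $$\frac{d^k}{dz^k}\Big(\frac{\mathbf H_1(z)}z\Big)=k!\,(-1)^k\Big[2\sum_{i=0}^{\lfloor k/2\rfloor}\frac{(-1)^i}{i!\,(k-2i)!}\frac{\mathbf H_{k+1-i}(z)}{(2z)^{i+1}}-E(k,z)\Big],$$ and $E(k,z)$ is a polynomial in $z$. (ii) For every integer $k\ge1$, $$\begin{aligned}\frac{(-1)^k}{k!}\frac{d^k}{dz^k}\Big(\frac{\mathbf H_1(z)}z\Big)&=\Big\{\sum_{i=0}^{\lceil k/2\rceil}\frac{(-1/4)^i}{i!\,(k-2i)!}\,\frac12\sum_{\kappa=0}^{\lceil (k-i)/2\rceil}\frac{\Gamma(k+1-i-\kappa)^2}{\Gamma(k+1-i-2\kappa)}\frac{(-1)^\kappa}{(\kappa!)^2}\Big(\frac z2\Big)^{2\kappa-k-1}\Big\}\mathbf H_1(z)\\&\quad-\Big\{\sum_{i=0}^{\lceil k/2\rceil}\frac{(-1/4)^i}{i!\,(k-2i)!}\,\frac12\sum_{\kappa=0}^{\lceil (k-1-i)/2\rceil}\frac{\Gamma(k+1-i-\kappa)\Gamma(k-i-\kappa)}{\Gamma(k-i-2\kappa)}\frac{(-1)^\kappa}{\kappa!\,(\kappa+1)!}\Big(\frac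 z2\Big)^{2\kappa-k}\Big\}\mathbf H_0(z)\\&\quad+2\sum_{i=0}^{\lceil k/2\rceil}\frac{(-1)^i}{i!\,(k-2i)!}\frac{\mathbf S(k+1-i,z)}{(2z)^{i+1}}-E(k,z).\end{aligned}$$ (iii) For every integer $k\ge0$, $$(-1)^k\frac{d^k}{dz^k}\Big(\frac{\mathbf H_1(z)}z\Big)=\mathbf H_0(z)\,\sigma_0(k,z)\Big(\frac2z\Big)^k+\mathbf H_1(z)\,\sigma_1(k,z)\Big(\frac2z\Big)^{k+1}+\sigma_2(k,z)\Big(\frac2z\Big)^{k-1},$$ where $\sigma_0,\sigma_1,\sigma_2$ are the following polynomials in $z$. Write $$a_n(\nu)=\frac12\sum_{i=0}^{n}\frac{(-1/4)^i}{i!\,(k-2i)!}\frac{(k-\nu-i)!\,(k-1-\nu-i)!}{(k-1-2\nu-i)!},\qquad b_n(\nu)=\frac12\sum_{i=0}^{n}\frac{(-1/4)^i}{i!\,(k-2i)!}\frac{(k-\nu-i)!^2}{(k-2\nu-i)!}.$$ Then $$\sigma_0(k,z)=k!\Big[\sum_{\nu=0}^{\lceil\frac12\lfloor\frac k2\rfloor-\frac12\rceil}a_{\lceil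 k/2\rceil}(\nu)\frac{(-1)^{\nu+1}}{\nu!(\nu+1)!}\Big(\frac z2\Big)^{2\nu}+\sum_{\nu=\lceil\frac12\lfloor\frac k2\rfloor+\frac12\rceil}^{\lceil\frac{k-1}2\rceil}a_{k-1-2\nu}(\nu)\frac{(-1)^{\nu+1}}{\nu!(\nu+1)!}\Big(\frac z2\Big)^{2\nu}\Big],$$ $$\sigma_1(k,z)=k!\Big[\sum_{\nu=0}^{\lceil\frac12\lfloor\frac k2\rfloor\rceil}b_{\lceil k/2\rceil}(\nu)\frac{(-1)^{\nu}}{(\nu!)^2}\Big(\frac z2\Big)^{2\nu}+\sum_{\nu=1+\lceil\frac12\lfloor\frac k2\rfloor\rceil}^{\lceil\frac k2\rceil}b_{k+1-2\nu}(\nu)\frac{(-1)^{\nu}}{(\nu!)^2}\Big(\frac z2\Big)^{2\nu}\Big],$$ $$\begin{aligned}\sigma_2(k,z)=k!\Big[&\frac{(-\frac14)^{\lfloor k/2\rfloor+1}\,\delta[1,\lceil\frac k2\rceil-\lfloor\frac k2\rfloor]}{\Gamma(\lfloor\frac k2\rfloor+\frac32)\Gamma(\lceil\frac k2\rceil+\frac32)}\Big(\frac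 z2\Big)^{k-1}+\frac1{2\pi}\sum_{\nu=1}^{\lceil\frac12\lfloor\frac k2\rfloor\rceil}\frac{\mathfrak C(k,\lceil\frac k2\rceil,\nu)}{\nu!}\Big(\frac z2\Big)^{2\nu-2}\\&+\frac1{2\pi}\sum_{\nu=1+\lceil\frac12\lfloor\frac k2\rfloor\rceil}^{\lceil\frac k2\rceil}\Big\{\frac{\mathfrak C(k,k+1-2\nu,\nu)}{\nu!}+\sum_{i=k+2-2\nu}^{\lceil k/2\rceil}\frac{(-1/4)^i}{i!\,(k-2i)!}\frac{\Gamma(k+\frac12-\nu-i)}{\Gamma(\nu+\frac32)}\Big\}\Big(\frac z2\Big)^{2\nu-2}\Big],\end{aligned}$$ with $\delta$ the Kronecker delta and $$\mathfrak C(k,a,\nu)=\sum_{j=0}^{a}\frac{(-1/4)^j}{j!}\frac{(k-\nu-j)!}{(k-2j)!}\sum_{i=0}^{\nu-1}\frac{(-1)^i}{i!}\frac{\sqrt\pi\,(k-j-i)!}{(k-\nu-j-i)!\,\Gamma(\nu+\frac32-i)}.$$ -/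

import Mathlib

noncomputable section

open Polynomial in
/-- The polynomial `(z / 2) ^ n` in the indeterminate `z`. -/
def halfPow (n : ℕ) : ℂ[X] := (C (1 / 2) * X) ^ n

/-- The Struve function `𝐇_n` of order `n = 0, 1, 2, …`, by its (everywhere convergent) series
`∑ (-1)^m (z/2)^(2m+n+1) / (Γ(m+3/2) Γ(m+n+3/2))`. -/
def struveH (n : ℕ) (z : ℂ) : ℂ :=
  ∑' m : ℕ, (-1 : ℂ) ^ m * (z / 2) ^ (2 * m + n + 1) /
    (Complex.Gamma (m + 3 / 2) * Complex.Gamma (m + n + 3 / 2))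

/-- `n !` for an integer `n ≥ 0`. The value `0` for `n < 0` is a placeholder: a factorial of a
negative integer stands in a numerator below only in terms which also carry a factor
`recipFact n = 0` with `n < 0`. -/
def intFact (n : ℤ) : ℂ := if 0 ≤ n then (n.toNat.factorial : ℂ) else 0

/-- `1 / n !` for an integer `n`, equal to `0` for `n < 0`. -/
def recipFact (n : ℤ) : ℂ := if 0 ≤ n then 1 / (n.toNat.factorial : ℂ) else 0

/-- The coefficients `C_n(ν, z)` of the recurrence to lower orders (Lommel polynomials in `1/z`):
`C_0 = 1`, `C_1 = 2 (ν - 1) / z`, `C_n = (2 (ν - n) / z) C_{n-1} - C_{n-2}`. -/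
def lommelC (ν : ℂ) (z : ℂ) : ℕ → ℂ
  | 0 => 1
  | 1 => 2 * (ν - 1) / z
  | n + 2 => 2 * (ν - (n + 2)) / z * lommelC ν z (n + 1) - lommelC ν z n

/-- `𝐒(ν, z) = π^(-1/2) ∑_{j=0}^{ν-2} (z/2)^(ν-1-j) / Γ(ν+1/2-j) · C_j(ν, z)`
for `ν = 1, 2, …`; the sum is empty for `ν = 1`. -/
def struveS (ν : ℕ) (z : ℂ) : ℂ :=
  1 / (Real.sqrt Real.pi : ℂ) * ∑ j ∈ Finset.range (ν - 1),
    (z / 2) ^ (ν - 1 - j) / Complex.Gamma (ν + 1 / 2 - j) * lommelC ν z j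

/-- The part of the formula for the `k`-th derivative that contains no Struve function:
`∑_{j=0}^{⌊k/2⌋} (-1)^j (z/2)^(k-1-2j) / Γ(k+3/2-j) ·
  ∑_{i=0}^{j} (1/2)^(2i+1) / (i! (k-2i)! Γ(i+1/2-j))`. -/
def elementaryPart (k : ℕ) (z : ℂ) : ℂ :=
  ∑ j ∈ Finset.range (k / 2 + 1),
    (-1 : ℂ) ^ j * (z / 2) ^ ((k : ℤ) - 1 - 2 * j) / Complex.Gamma (k + 3 / 2 - j) *
      ∑ i ∈ Finset.range (j + 1),
        (1 / 2 : ℂ) ^ (2 * i + 1) /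
          ((i.factorial : ℂ) * ((k - 2 * i).factorial : ℂ) * Complex.Gamma (i + 1 / 2 - j))

/-- The prefactor of `𝐇_1(z)` as a double sum. Here `⌈k/2⌉ = (k+1)/2` and `⌈(k-i)/2⌉ = (k-i+1)/2`
with integer division; `1 / Γ` vanishes at the non-positive integers (in Mathlib `Γ = 0` there,
and division by zero gives `0`). -/
def prefactorH1 (k : ℕ) (z : ℂ) : ℂ :=
  ∑ i ∈ Finset.range ((k + 1) / 2 + 1),
    (-1 / 4 : ℂ) ^ i / (i.factorial : ℂ) * recipFact ((k : ℤ) - 2 * i) * (1 / 2) *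
      ∑ κ ∈ Finset.range ((k - i + 1) / 2 + 1),
        Complex.Gamma (k + 1 - i - κ) ^ 2 / Complex.Gamma (k + 1 - i - 2 * κ) *
          ((-1 : ℂ) ^ κ / (κ.factorial : ℂ) ^ 2) * (z / 2) ^ (2 * (κ : ℤ) - k - 1)

/-- The prefactor of `-𝐇_0(z)` as a double sum; `⌈(k-1-i)/2⌉ = (k-i)/2` with integer division. -/
def prefactorH0 (k : ℕ) (z : ℂ) : ℂ :=
  ∑ i ∈ Finset.range ((k + 1) / 2 + 1),
    (-1 / 4 : ℂ) ^ i / (i.factorial : ℂ) * recipFact ((k : ℤ) - 2 * i) * (1 / 2) *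
      ∑ κ ∈ Finset.range ((k - i) / 2 + 1),
        Complex.Gamma (k + 1 - i - κ) * Complex.Gamma (k - i - κ) /
            Complex.Gamma (k - i - 2 * κ) *
          ((-1 : ℂ) ^ κ / ((κ.factorial : ℂ) * ((κ + 1).factorial : ℂ))) *
          (z / 2) ^ (2 * (κ : ℤ) - k)

/-- The inner coefficient of `σ₀`, with summation over `0 ≤ i < n`. -/
def sigma0Coeff (k n ν : ℕ) : ℂ :=
  1 / 2 * ∑ i ∈ Finset.range n,
    (-1 / 4 : ℂ) ^ i / (i.factorial : ℂ) * recipFact ((k : ℤ) - 2 * i) *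
      (intFact ((k : ℤ) - ν - i) * intFact ((k : ℤ) - 1 - ν - i) *
        recipFact ((k : ℤ) - 1 - 2 * ν - i))

open Polynomial in
/-- `σ₀(k, z)`. With `m = ⌊k/2⌋` and integer division, the limits are `⌈m/2 - 1/2⌉ = m/2`,
`⌈m/2 + 1/2⌉ = m/2 + 1`, `⌈(k-1)/2⌉ = k/2`; the inner sums run over `0 ≤ i ≤ ⌈k/2⌉` and
`0 ≤ i ≤ k - 1 - 2ν`. -/
def sigma0 (k : ℕ) : ℂ[X] :=
  C (k.factorial : ℂ) *
    (∑ ν ∈ Finset.range (k / 2 / 2 + 1),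
        C (sigma0Coeff k ((k + 1) / 2 + 1) ν *
          ((-1 : ℂ) ^ (ν + 1) / ((ν.factorial : ℂ) * ((ν + 1).factorial : ℂ)))) *
          halfPow (2 * ν)
      + ∑ ν ∈ Finset.Icc (k / 2 / 2 + 1) (k / 2),
        C (sigma0Coeff k (k - 2 * ν) ν *
          ((-1 : ℂ) ^ (ν + 1) / ((ν.factorial : ℂ) * ((ν + 1).factorial : ℂ)))) *
          halfPow (2 * ν))

/-- The inner coefficient of `σ₁`, with summation over `0 ≤ i < n`. -/
def sigma1Coeff (k n ν : ℕ) : ℂ :=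
  1 / 2 * ∑ i ∈ Finset.range n,
    (-1 / 4 : ℂ) ^ i / (i.factorial : ℂ) * recipFact ((k : ℤ) - 2 * i) *
      (intFact ((k : ℤ) - ν - i) ^ 2 * recipFact ((k : ℤ) - 2 * ν - i))

open Polynomial in
/-- `σ₁(k, z)`. With `m = ⌊k/2⌋` and integer division, `⌈m/2⌉ = (m+1)/2` and `⌈k/2⌉ = (k+1)/2`;
the inner sums run over `0 ≤ i ≤ ⌈k/2⌉` and `0 ≤ i ≤ k + 1 - 2ν`. -/
def sigma1 (k : ℕ) : ℂ[X] :=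
  C (k.factorial : ℂ) *
    (∑ ν ∈ Finset.range ((k / 2 + 1) / 2 + 1),
        C (sigma1Coeff k ((k + 1) / 2 + 1) ν *
          ((-1 : ℂ) ^ ν / (ν.factorial : ℂ) ^ 2)) * halfPow (2 * ν)
      + ∑ ν ∈ Finset.Icc (1 + (k / 2 + 1) / 2) ((k + 1) / 2),
        C (sigma1Coeff k (k + 2 - 2 * ν) ν *
          ((-1 : ℂ) ^ ν / (ν.factorial : ℂ) ^ 2)) * halfPow (2 * ν))

/-- The coefficients `ℭ(k, a, ν)`. -/
def frakC (k a ν : ℕ) : ℂ :=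
  ∑ j ∈ Finset.range (a + 1),
    (-1 / 4 : ℂ) ^ j / (j.factorial : ℂ) *
      (intFact ((k : ℤ) - ν - j) * recipFact ((k : ℤ) - 2 * j)) *
      ∑ i ∈ Finset.range ν,
        (-1 : ℂ) ^ i / (i.factorial : ℂ) *
          ((Real.sqrt Real.pi : ℂ) * intFact ((k : ℤ) - j - i) *
            recipFact ((k : ℤ) - ν - j - i) / Complex.Gamma (ν + 3 / 2 - i))

open Polynomial in
/-- `σ₂(k, z)`; the Kronecker delta `δ[1, ⌈k/2⌉ - ⌊k/2⌋]` is written as an `if`. -/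
def sigma2 (k : ℕ) : ℂ[X] :=
  C (k.factorial : ℂ) *
    (C ((-1 / 4 : ℂ) ^ (k / 2 + 1) * (if 1 = (k + 1) / 2 - k / 2 then 1 else 0) /
        (Complex.Gamma ((k / 2 : ℕ) + 3 / 2) * Complex.Gamma (((k + 1) / 2 : ℕ) + 3 / 2))) *
        halfPow (k - 1)
      + C (1 / (2 * (Real.pi : ℂ))) * ∑ ν ∈ Finset.Icc 1 ((k / 2 + 1) / 2),
        C (frakC k ((k + 1) / 2) ν / (ν.factorial : ℂ)) * halfPow (2 * ν - 2)
      + C (1 / (2 * (Real.pi : ℂ))) * ∑ ν ∈ Finset.Icc (1 + (k / 2 + 1) / 2) ((k + 1) / 2),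
        C (frakC k (k + 1 - 2 * ν) ν / (ν.factorial : ℂ) +
          ∑ i ∈ Finset.Icc (k + 2 - 2 * ν) ((k + 1) / 2),
            (-1 / 4 : ℂ) ^ i / (i.factorial : ℂ) * recipFact ((k : ℤ) - 2 * i) *
              (Complex.Gamma (k + 1 / 2 - ν - i) / Complex.Gamma (ν + 3 / 2))) *
          halfPow (2 * ν - 2))

end

/-!
Put `w = z / 2`. Lowering both Gamma functions in the series of `𝐇_n` shifts it by one term
(`Struve.hasSum_struve_shift`), which gives at once the derivative
`𝐇_n' = (n / z) 𝐇_n - 𝐇_{n+1} + s_n` and the three-term recurrence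
`𝐇_n = (2 (n + 1) / z) 𝐇_{n+1} - 𝐇_{n+2} + s_{n+1}`, where `s_n = w ^ n / (√π Γ(n + 3/2))`.

The derivatives of `𝐇_1(z) / z` in terms of higher orders follow by induction on `k`. The
coefficients `1 / (i! (k - 2i)!)` satisfy a Pascal-type recurrence (`Struve.hermiteCoeff`); the
terms `s_n` add up to the elementary part, whose coefficients are partial sums of a Gauss sum and
satisfy the same kind of recurrence (`Struve.gaussPartial_succ_succ`). Where a partial sum contains
all nonzero terms, Gauss's theorem applies: it shows that the negative powers of `z` cancel, so that
the elementary part is a polynomial.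

Iterating the three-term recurrence downwards expresses `𝐇_n` by `𝐇_1`, `𝐇_0` and `𝐒(n, z)`, with
Lommel polynomials in `1 / z` as coefficients; their explicit form (`Struve.lommelC_eq_sum`) gives
the prefactors as double sums, and exchanging the summations gives `σ₀` and `σ₁`.

For `σ₂`, the sums `𝐒(n, z)` are arranged by powers of `w`. The inner alternating sum is a
Chu-Vandermonde sum, truncated at `ν` terms; when it is not truncated, it has a closed form
(`Struve.struveSCoeff_eq`), and by the reflection formula for Gamma the corresponding terms are
those of the elementary part (`Struve.reductionCoeffRest_eq_elementaryCoeff`). Hence only the powers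
`(z / 2) ^ (2 ν - 1 - k)` with `1 ≤ ν ≤ k / 2` survive. For odd `k` the definition of `σ₂` has an
additional power with `ν = (k + 1) / 2`, which its Kronecker delta term cancels
(`Struve.delta_term_eq`).
-/

namespace Struve

/-! ### Factorials of integers and the Gamma function -/

theorem recipFact_of_neg {n : ℤ} (hn : n < 0) : recipFact n = 0 := by
  simp [recipFact, not_le.mpr hn]

theorem recipFact_natCast (n : ℕ) : recipFact n = 1 / (n.factorial : ℂ) := by
  simp [recipFact]

theorem intFact_of_neg {n : ℤ} (hn : n < 0) : intFact n = 0 := by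
  simp [intFact, not_le.mpr hn]

theorem intFact_natCast (n : ℕ) : intFact n = (n.factorial : ℂ) := by
  simp [intFact]

/-- The functional equation of `1 / Γ`; at `n = -1` both sides are zero. -/
theorem recipFact_eq_succ_mul (n : ℤ) : recipFact n = (n + 1) * recipFact (n + 1) := by
  rcases lt_or_ge n 0 with hn | hn
  · rw [recipFact_of_neg hn]
    rcases eq_or_lt_of_le (Int.add_one_le_iff.mpr hn) with h | h
    · have : (n : ℂ) + 1 = 0 := by exact_mod_cast h
      rw [this, zero_mul]
    · rw [recipFact_of_neg h, mul_zero]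
  · lift n to ℕ using hn
    have h : ((n : ℤ) + 1) = ((n + 1 : ℕ) : ℤ) := by push_cast; rfl
    rw [h, recipFact_natCast, recipFact_natCast, Nat.factorial_succ]
    have h1 : (n.factorial : ℂ) ≠ 0 := by exact_mod_cast n.factorial_ne_zero
    have h2 : ((n : ℂ) + 1) ≠ 0 := by exact_mod_cast n.succ_ne_zero
    push_cast
    field_simp

theorem intFact_succ {n : ℤ} (hn : 0 ≤ n) : intFact (n + 1) = (n + 1) * intFact n := by
  lift n to ℕ using hn
  have h : ((n : ℤ) + 1) = ((n + 1 : ℕ) : ℤ) := by push_cast; rfl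
  rw [h, intFact_natCast, intFact_natCast, Nat.factorial_succ]
  push_cast
  rfl

/-- This includes `n < 0`, where Mathlib's `Complex.Gamma` has the value `0` at its poles. -/
theorem Gamma_intCast_add_one (n : ℤ) : Complex.Gamma (n + 1) = intFact n := by
  rcases lt_or_ge n 0 with hn | hn
  · rw [intFact_of_neg hn]
    obtain ⟨m, hm⟩ := Int.eq_ofNat_of_zero_le (show 0 ≤ -(n + 1) by omega)
    have : (n : ℂ) + 1 = -(m : ℂ) := by
      have h : n + 1 = -(m : ℤ) := by omega
      exact_mod_cast h
    rw [this, Complex.Gamma_neg_nat_eq_zero]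
  · lift n to ℕ using hn
    rw [intFact_natCast, Int.cast_natCast, Complex.Gamma_nat_eq_factorial]

theorem inv_Gamma_intCast_add_one (n : ℤ) : (Complex.Gamma (n + 1))⁻¹ = recipFact n := by
  rw [Gamma_intCast_add_one]
  rcases lt_or_ge n 0 with hn | hn
  · rw [intFact_of_neg hn, recipFact_of_neg hn, inv_zero]
  · lift n to ℕ using hn
    rw [intFact_natCast, recipFact_natCast, one_div]

theorem inv_Gamma_eq (s : ℂ) :
    (Complex.Gamma s)⁻¹ = s * (Complex.Gamma (s + 1))⁻¹ :=
  Complex.one_div_Gamma_eq_self_mul_one_div_Gamma_add_one s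

theorem sqrt_pi_sq : (Real.sqrt Real.pi : ℂ) ^ 2 = (Real.pi : ℂ) := by
  rw [← Complex.ofReal_pow, Real.sq_sqrt Real.pi_pos.le]

theorem sqrt_pi_ne_zero : (Real.sqrt Real.pi : ℂ) ≠ 0 :=
  Complex.ofReal_ne_zero.mpr (Real.sqrt_ne_zero'.mpr Real.pi_pos)

theorem Gamma_half : Complex.Gamma (1 / 2) = (Real.sqrt Real.pi : ℂ) := by
  rw [Complex.Gamma_one_half_eq, ← Complex.ofReal_ofNat, ← Complex.ofReal_one,
    ← Complex.ofReal_div, ← Complex.ofReal_cpow Real.pi_pos.le, Real.sqrt_eq_rpow]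

/-- The Gamma function has no zero on the half-integers, negative ones included. -/
theorem Gamma_intCast_add_half_ne_zero (n : ℤ) : Complex.Gamma (n + 1 / 2) ≠ 0 := by
  refine Complex.Gamma_ne_zero fun m hm => ?_
  have h : ((2 * n + 1 + 2 * m : ℤ) : ℂ) = 0 := by
    push_cast
    linear_combination 2 * hm
  have : 2 * n + 1 + 2 * (m : ℤ) = 0 := by exact_mod_cast h
  omega

theorem natCast_add_half_ne_zero (r : ℕ) : (r : ℂ) + 1 / 2 ≠ 0 := by
  intro h
  have : ((2 * r + 1 : ℕ) : ℂ) = 0 := by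
    push_cast
    linear_combination 2 * h
  exact absurd (Nat.cast_eq_zero.mp this) (Nat.succ_ne_zero _)

/-- The reflection formula at half-integers. -/
theorem inv_Gamma_half_sub (r : ℕ) :
    (Complex.Gamma (1 / 2 - r))⁻¹ = (-1) ^ r * Complex.Gamma (r + 1 / 2) / (Real.pi : ℂ) := by
  induction r with
  | zero =>
    have := sqrt_pi_ne_zero
    simp only [Nat.cast_zero, sub_zero, zero_add, pow_zero, one_mul, Gamma_half, ← sqrt_pi_sq]
    field_simp
  | succ r ih =>
    rw [inv_Gamma_eq]
    have h1 : (1 / 2 - ((r + 1 : ℕ) : ℂ) + 1) = 1 / 2 - r := by push_cast; ring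
    have h2 : (((r + 1 : ℕ) : ℂ) + 1 / 2) = ((r : ℂ) + 1 / 2) + 1 := by push_cast; ring
    have h3 := natCast_add_half_ne_zero r
    rw [h1, h2, ih, Complex.Gamma_add_one _ h3]
    push_cast
    ring

theorem ascPochhammer_half (r : ℕ) :
    (ascPochhammer ℂ r).eval (1 / 2) = Complex.Gamma (r + 1 / 2) / (Real.sqrt Real.pi : ℂ) := by
  induction r with
  | zero =>
    rw [ascPochhammer_zero, Polynomial.eval_one, Nat.cast_zero, zero_add, Gamma_half,
      div_self sqrt_pi_ne_zero]
  | succ r ih =>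
    have h2 : (((r + 1 : ℕ) : ℂ) + 1 / 2) = ((r : ℂ) + 1 / 2) + 1 := by push_cast; ring
    have h3 := natCast_add_half_ne_zero r
    rw [ascPochhammer_succ_eval, ih, h2, Complex.Gamma_add_one _ h3]
    ring

/-! ### Coefficients of the derivatives of a function of `z ^ 2` -/

/-- `k! * hermiteCoeff k i` is, up to a power of `2`, the coefficient with which the
`(k - i)`-th derivative of `g` enters the `k`-th derivative of `z ↦ g (z ^ 2)`. -/
noncomputable def hermiteCoeff (k i : ℕ) : ℂ := recipFact ((k : ℤ) - 2 * i) / (i.factorial : ℂ)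

theorem hermiteCoeff_eq_zero {k i : ℕ} (h : k < 2 * i) : hermiteCoeff k i = 0 := by
  rw [hermiteCoeff, recipFact_of_neg (by omega), zero_div]

theorem hermiteCoeff_eq {k i : ℕ} (h : 2 * i ≤ k) :
    hermiteCoeff k i = 1 / ((i.factorial : ℂ) * ((k - 2 * i).factorial : ℂ)) := by
  have : (k : ℤ) - 2 * i = ((k - 2 * i : ℕ) : ℤ) := by omega
  rw [hermiteCoeff, this, recipFact_natCast, div_div, mul_comm]

theorem succ_mul_hermiteCoeff_succ_zero (k : ℕ) :
    ((k : ℂ) + 1) * hermiteCoeff (k + 1) 0 = hermiteCoeff k 0 := by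
  have := recipFact_eq_succ_mul (k : ℤ)
  simp only [hermiteCoeff]
  push_cast at this ⊢
  simp only [sub_zero, Nat.factorial_zero, Nat.cast_one, div_one]
  exact this.symm

theorem succ_mul_hermiteCoeff_succ_succ (k i : ℕ) :
    ((k : ℂ) + 1) * hermiteCoeff (k + 1) (i + 1) =
      hermiteCoeff k (i + 1) + 2 * ((k : ℂ) - 2 * i) * hermiteCoeff k i := by
  have h1 := recipFact_eq_succ_mul ((k : ℤ) - 2 * (i + 1))
  have h2 := recipFact_eq_succ_mul ((k : ℤ) - 2 * i - 1)
  have e1 : (k : ℤ) - 2 * (i + 1) + 1 = (k : ℤ) - 2 * i - 1 := by ring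
  have e2 : (k : ℤ) - 2 * i - 1 + 1 = (k : ℤ) - 2 * i := by ring
  have e3 : (k : ℤ) + 1 - 2 * (i + 1) = (k : ℤ) - 2 * i - 1 := by ring
  rw [e1] at h1
  rw [e2] at h2
  have hi : (i.factorial : ℂ) ≠ 0 := by exact_mod_cast i.factorial_ne_zero
  have hi' : ((i : ℂ) + 1) ≠ 0 := by exact_mod_cast i.succ_ne_zero
  simp only [hermiteCoeff, Nat.factorial_succ]
  push_cast at h1 h2 ⊢
  rw [e3, h1]
  field_simp
  linear_combination (2 * (i + 1) : ℂ) * h2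

/-- Pascal-type recurrence for the sums against `hermiteCoeff`, truncated at an arbitrary place. -/
theorem succ_mul_sum_hermiteCoeff (k n : ℕ) (u : ℕ → ℂ) :
    ((k : ℂ) + 1) * ∑ i ∈ Finset.range (n + 1), hermiteCoeff (k + 1) i * u i =
      ∑ i ∈ Finset.range (n + 1), hermiteCoeff k i * u i +
        ∑ i ∈ Finset.range n, 2 * ((k : ℂ) - 2 * i) * hermiteCoeff k i * u (i + 1) := by
  rw [Finset.sum_range_succ', Finset.sum_range_succ' (fun i => hermiteCoeff k i * u i), mul_add,
    ← mul_assoc, succ_mul_hermiteCoeff_succ_zero, Finset.mul_sum, add_right_comm,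
    ← Finset.sum_add_distrib]
  congr 1
  refine Finset.sum_congr rfl fun i _ => ?_
  rw [← mul_assoc, succ_mul_hermiteCoeff_succ_succ]
  ring

theorem succ_mul_sum_hermiteCoeff_full (k : ℕ) (u : ℕ → ℂ) :
    ((k : ℂ) + 1) * ∑ i ∈ Finset.range (k + 2), hermiteCoeff (k + 1) i * u i =
      ∑ i ∈ Finset.range (k + 1),
        hermiteCoeff k i * (u i + 2 * ((k : ℂ) - 2 * i) * u (i + 1)) := by
  rw [succ_mul_sum_hermiteCoeff, Finset.sum_range_succ _ (k + 1),
    hermiteCoeff_eq_zero (by omega : k < 2 * (k + 1)), zero_mul, add_zero,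
    ← Finset.sum_add_distrib]
  exact Finset.sum_congr rfl fun i _ => by ring

/-- An instance of Gauss's summation theorem, in a form without poles. -/
theorem factorial_mul_sum_hermiteCoeff_Gamma (k : ℕ) (y : ℂ) :
    (k.factorial : ℂ) * ∑ i ∈ Finset.range (k + 1),
        hermiteCoeff k i * ((1 / 4) ^ i * (Complex.Gamma (y + i))⁻¹) =
      (∏ l ∈ Finset.range k, (y + k - 1 - l / 2)) * (Complex.Gamma (y + k))⁻¹ := by
  induction k generalizing y with
  | zero => simp [hermiteCoeff, recipFact]
  | succ k ih =>
    have key := succ_mul_sum_hermiteCoeff_full k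
      fun i => (1 / 4) ^ i * (Complex.Gamma (y + i))⁻¹
    have h : ∀ i : ℕ, (1 / 4 : ℂ) ^ i * (Complex.Gamma (y + i))⁻¹ + 2 * ((k : ℂ) - 2 * i) *
        ((1 / 4) ^ (i + 1) * (Complex.Gamma (y + (i + 1 : ℕ)))⁻¹) =
        (y + k / 2) * ((1 / 4) ^ i * (Complex.Gamma (y + 1 + i))⁻¹) := fun i => by
      have e : y + ((i + 1 : ℕ) : ℂ) = y + i + 1 := by push_cast; ring
      have e' : y + 1 + (i : ℂ) = y + i + 1 := by ring
      rw [inv_Gamma_eq (y + i), e, e']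
      ring
    simp only [h, mul_left_comm _ (y + k / 2), ← Finset.mul_sum] at key
    rw [Nat.factorial_succ, Nat.cast_mul, mul_right_comm, mul_comm, Nat.cast_succ, key,
      mul_left_comm, ih, Finset.prod_range_succ]
    have e : y + ((k : ℂ) + 1) = y + 1 + k := by ring
    rw [e]
    ring

/-- An instance of the Chu-Vandermonde identity, in a form without poles. -/
theorem sum_choose_factorial_Gamma (r ν : ℕ) (y : ℂ) :
    ∑ κ ∈ Finset.range (r + 1), (r.choose κ : ℂ) * ((-1 : ℂ) ^ κ *
        ((ν + (r - κ)).factorial : ℂ) * (Complex.Gamma (y - κ))⁻¹) =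
      (ν.factorial : ℂ) * (ascPochhammer ℂ r).eval (ν + 2 - y) * (Complex.Gamma y)⁻¹ := by
  induction r generalizing ν y with
  | zero => simp
  | succ r ih =>
    have h1 := ih (ν + 1) y
    have h2 := ih ν (y - 1)
    rw [Finset.sum_choose_succ_mul (fun i j => (-1 : ℂ) ^ i *
      ((ν + j).factorial : ℂ) * (Complex.Gamma (y - i))⁻¹)]
    have e1 : ∑ κ ∈ Finset.range (r + 1), (r.choose κ : ℂ) * ((-1 : ℂ) ^ κ *
        ((ν + (r + 1 - κ)).factorial : ℂ) * (Complex.Gamma (y - κ))⁻¹) =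
        ∑ κ ∈ Finset.range (r + 1), (r.choose κ : ℂ) * ((-1 : ℂ) ^ κ *
        ((ν + 1 + (r - κ)).factorial : ℂ) * (Complex.Gamma (y - κ))⁻¹) := by
      refine Finset.sum_congr rfl fun κ hκ => ?_
      rw [show ν + (r + 1 - κ) = ν + 1 + (r - κ) by
        have := Finset.mem_range.mp hκ
        omega]
    have e2 : ∑ κ ∈ Finset.range (r + 1), (r.choose κ : ℂ) * ((-1 : ℂ) ^ (κ + 1) *
        ((ν + (r - κ)).factorial : ℂ) * (Complex.Gamma (y - (κ + 1 : ℕ)))⁻¹) =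
        -∑ κ ∈ Finset.range (r + 1), (r.choose κ : ℂ) * ((-1 : ℂ) ^ κ *
        ((ν + (r - κ)).factorial : ℂ) * (Complex.Gamma (y - 1 - κ))⁻¹) := by
      rw [← Finset.sum_neg_distrib]
      refine Finset.sum_congr rfl fun κ _ => ?_
      rw [show y - ((κ + 1 : ℕ) : ℂ) = y - 1 - κ by push_cast; ring]
      ring
    have e3 : ((ν + 1 : ℕ) : ℂ) + 2 - y = (ν + 2 - y) + 1 := by push_cast; ring
    have e4 : (ν : ℂ) + 2 - (y - 1) = (ν + 2 - y) + 1 := by ring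
    rw [e1, e2, h1, h2, inv_Gamma_eq (y - 1), sub_add_cancel, e3, e4, ascPochhammer_succ_left,
      Polynomial.eval_mul, Polynomial.eval_X, Polynomial.eval_comp, Polynomial.eval_add,
      Polynomial.eval_X, Polynomial.eval_one, Nat.factorial_succ]
    push_cast
    ring

/-! ### The Struve functions: derivative and three-term recurrence -/

/-- The summand of the series that defines `struveH n z`. -/
noncomputable def struveTerm (n m : ℕ) (z : ℂ) : ℂ :=
  (-1 : ℂ) ^ m * (z / 2) ^ (2 * m + n + 1) /
    (Complex.Gamma (m + 3 / 2) * Complex.Gamma (m + n + 3 / 2))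

/-- The inhomogeneous term `(z / 2) ^ n / (√π Γ(n + 3 / 2))` of the recurrences below. -/
noncomputable def struveInhom (n : ℕ) (z : ℂ) : ℂ :=
  (z / 2) ^ n / ((Real.sqrt Real.pi : ℂ) * Complex.Gamma (n + 3 / 2))

theorem natCast_add_three_halves_ne_zero (m : ℕ) : (m : ℂ) + 3 / 2 ≠ 0 := by
  have h := natCast_add_half_ne_zero (m + 1)
  rwa [show (((m + 1 : ℕ) : ℂ) + 1 / 2) = m + 3 / 2 by push_cast; ring] at h

theorem Gamma_natCast_add_three_halves_ne_zero (m : ℕ) : Complex.Gamma (m + 3 / 2) ≠ 0 := by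
  have h := Gamma_intCast_add_half_ne_zero (m + 1)
  rwa [show (((m + 1 : ℤ) : ℂ) + 1 / 2) = m + 3 / 2 by push_cast; ring] at h

theorem Gamma_natCast_add_five_halves (m : ℕ) :
    Complex.Gamma (m + 3 / 2 + 1) = (m + 3 / 2) * Complex.Gamma (m + 3 / 2) :=
  Complex.Gamma_add_one _ (natCast_add_three_halves_ne_zero m)

/-- The ratio of consecutive terms, without division. -/
theorem struveTerm_succ (n m : ℕ) (z : ℂ) :
    ((m : ℂ) + 3 / 2) * (m + n + 3 / 2) * struveTerm n (m + 1) z =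
      -(z / 2) ^ 2 * struveTerm n m z := by
  have h1 := Gamma_natCast_add_five_halves m
  have h2 := Gamma_natCast_add_five_halves (m + n)
  have h3 := Gamma_natCast_add_three_halves_ne_zero m
  have h4 := Gamma_natCast_add_three_halves_ne_zero (m + n)
  have h5 := natCast_add_three_halves_ne_zero m
  have h6 := natCast_add_three_halves_ne_zero (m + n)
  push_cast at h2 h4 h6
  rw [struveTerm, struveTerm, show ((m + 1 : ℕ) : ℂ) + 3 / 2 = m + 3 / 2 + 1 by push_cast; ring,
    show ((m + 1 : ℕ) : ℂ) + n + 3 / 2 = m + n + 3 / 2 + 1 by push_cast; ring, h1, h2]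
  generalize Complex.Gamma (m + 3 / 2) = a at *
  generalize Complex.Gamma (m + n + 3 / 2) = b at *
  generalize (m : ℂ) + 3 / 2 = c at *
  generalize (m : ℂ) + n + 3 / 2 = d at *
  field_simp
  ring

theorem summable_struveTerm (n : ℕ) (z : ℂ) : Summable fun m => struveTerm n m z := by
  refine summable_of_ratio_norm_eventually_le (r := 1 / 2) (by norm_num) ?_
  obtain ⟨N, hN⟩ := exists_nat_ge (2 * ‖z / 2‖ ^ 2)
  filter_upwards [Filter.eventually_ge_atTop N] with m hm
  have h := congrArg norm (struveTerm_succ n m z)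
  rw [norm_mul, norm_mul, norm_mul, norm_neg, norm_pow] at h
  have h1 : (m : ℝ) ≤ ‖(m : ℂ) + 3 / 2‖ := by
    refine le_trans ?_ (Complex.re_le_norm _)
    norm_num
  have h2 : (1 : ℝ) ≤ ‖(m : ℂ) + n + 3 / 2‖ := by
    refine le_trans ?_ (Complex.re_le_norm _)
    norm_num
    have : (0 : ℝ) ≤ (m : ℝ) + n := by positivity
    linarith
  have h1' : ‖(m : ℂ) + 3 / 2‖ ≠ 0 := norm_ne_zero_iff.mpr (natCast_add_three_halves_ne_zero m)
  have h3 : 2 * ‖z / 2‖ ^ 2 ≤ ‖(m : ℂ) + 3 / 2‖ :=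
    le_trans hN (le_trans (by exact_mod_cast hm) h1)
  have h4 : ‖(m : ℂ) + 3 / 2‖ * ‖struveTerm n (m + 1) z‖ ≤
      ‖(m : ℂ) + 3 / 2‖ * (1 / 2 * ‖struveTerm n m z‖) := by
    calc ‖(m : ℂ) + 3 / 2‖ * ‖struveTerm n (m + 1) z‖
        ≤ ‖(m : ℂ) + 3 / 2‖ * ‖(m : ℂ) + n + 3 / 2‖ * ‖struveTerm n (m + 1) z‖ := by
          gcongr
          exact le_mul_of_one_le_right (norm_nonneg _) h2
      _ = ‖z / 2‖ ^ 2 * ‖struveTerm n m z‖ := h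
      _ ≤ ‖(m : ℂ) + 3 / 2‖ * (1 / 2 * ‖struveTerm n m z‖) := by
          rw [← mul_assoc]
          gcongr
          linarith
  exact le_of_mul_le_mul_left h4 (lt_of_le_of_ne (norm_nonneg _) h1'.symm)

theorem hasSum_struveH (n : ℕ) (z : ℂ) : HasSum (fun m => struveTerm n m z) (struveH n z) :=
  (summable_struveTerm n z).hasSum

/-- Lowering both Gamma functions shifts the Struve series by one term. -/
theorem hasSum_struve_shift (n : ℕ) (z : ℂ) :
    HasSum (fun m : ℕ => (-1 : ℂ) ^ m * (z / 2) ^ (2 * m + n) /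
      (Complex.Gamma (m + 1 / 2) * Complex.Gamma (m + n + 3 / 2)))
      (struveInhom n z - struveH (n + 1) z) := by
  have h := (hasSum_struveH (n + 1) z).neg
  rw [sub_eq_neg_add]
  have h0 : struveInhom n z = ∑ m ∈ Finset.range 1, (-1 : ℂ) ^ m * (z / 2) ^ (2 * m + n) /
      (Complex.Gamma (m + 1 / 2) * Complex.Gamma (m + n + 3 / 2)) := by
    simp [struveInhom, ← Gamma_half]
  rw [h0, ← hasSum_nat_add_iff 1]
  convert h using 2 with m
  rw [struveTerm, show ((m + 1 : ℕ) : ℂ) + 1 / 2 = m + 3 / 2 by push_cast; ring,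
    show ((m + 1 : ℕ) : ℂ) + n + 3 / 2 = m + (n + 1 : ℕ) + 3 / 2 by push_cast; ring]
  ring

theorem struveH_sub (n : ℕ) {z : ℂ} (hz : z ≠ 0) :
    struveH n z - 2 * (n + 1) / z * struveH (n + 1) z =
      struveInhom (n + 1) z - struveH (n + 2) z := by
  refine HasSum.unique ((hasSum_struveH n z).sub ((hasSum_struveH (n + 1) z).mul_left _)) ?_
  refine (hasSum_struve_shift (n + 1) z).congr_fun fun m => ?_
  have h2 := Gamma_natCast_add_five_halves (m + n)
  have h3 := Gamma_natCast_add_three_halves_ne_zero m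
  have h4 := Gamma_natCast_add_three_halves_ne_zero (m + n)
  have h6 := natCast_add_three_halves_ne_zero (m + n)
  have h7 := inv_Gamma_eq ((m : ℂ) + 1 / 2)
  push_cast at h2 h4 h6
  rw [show (m : ℂ) + 1 / 2 + 1 = m + 3 / 2 by ring] at h7
  rw [struveTerm, struveTerm,
    show (m : ℂ) + (n + 1 : ℕ) + 3 / 2 = m + n + 3 / 2 + 1 by push_cast; ring, h2,
    div_eq_mul_inv _ (Complex.Gamma (m + 1 / 2) * _), mul_inv (Complex.Gamma (m + 1 / 2)), h7]
  generalize Complex.Gamma (m + 3 / 2) = a at *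
  generalize Complex.Gamma (m + n + 3 / 2) = b at *
  have hd : (m : ℂ) + n = (m + n + 3 / 2) - 3 / 2 := by ring
  have hn : (n : ℂ) = (m + n + 3 / 2) - 3 / 2 - m := by ring
  generalize (m : ℂ) + n + 3 / 2 = d at *
  rw [hn]
  field_simp
  ring

theorem hasDerivAt_struveTerm (n m : ℕ) {z : ℂ} (hz : z ≠ 0) :
    HasDerivAt (struveTerm n m) (n / z * struveTerm n m z + (-1 : ℂ) ^ m * (z / 2) ^ (2 * m + n) /
      (Complex.Gamma (m + 1 / 2) * Complex.Gamma (m + n + 3 / 2))) z := by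
  have h := ((((hasDerivAt_id z).div_const 2).pow (2 * m + n + 1)).const_mul
    ((-1 : ℂ) ^ m)).div_const (Complex.Gamma (m + 3 / 2) * Complex.Gamma (m + n + 3 / 2))
  refine h.congr_deriv ?_
  have h3 := Gamma_natCast_add_three_halves_ne_zero m
  have h4 := Gamma_natCast_add_three_halves_ne_zero (m + n)
  have h7 := inv_Gamma_eq ((m : ℂ) + 1 / 2)
  push_cast at h4
  rw [show (m : ℂ) + 1 / 2 + 1 = m + 3 / 2 by ring] at h7
  rw [struveTerm,
    div_eq_mul_inv _ (Complex.Gamma (m + 1 / 2) * _), mul_inv (Complex.Gamma (m + 1 / 2)), h7,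
    add_tsub_cancel_right]
  generalize Complex.Gamma (m + 3 / 2) = a at *
  generalize Complex.Gamma (m + n + 3 / 2) = b at *
  simp only [id]
  push_cast
  field_simp
  ring

/-- On the disc of radius `R` the series is dominated by its terms at the point `R`. -/
theorem norm_struveTerm_le (n m : ℕ) {z : ℂ} {R : ℝ} (hz : ‖z‖ ≤ R) :
    ‖struveTerm n m z‖ ≤ ‖struveTerm n m R‖ := by
  rw [struveTerm, struveTerm, norm_div, norm_div, norm_mul ((-1) ^ m), norm_mul ((-1) ^ m),
    norm_pow (z / 2), norm_pow ((R : ℂ) / 2), norm_div, norm_div, Complex.norm_real]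
  gcongr
  exact hz.trans (le_abs_self R)

theorem differentiable_struveTerm (n m : ℕ) : Differentiable ℂ (struveTerm n m) := by
  unfold struveTerm
  fun_prop

theorem differentiable_struveH (n : ℕ) : Differentiable ℂ (struveH n) := by
  intro z
  have h : DifferentiableOn ℂ (fun w => ∑' m, struveTerm n m w) (Metric.ball 0 (‖z‖ + 1)) :=
    Complex.differentiableOn_tsum_of_summable_norm
      (summable_struveTerm n ((‖z‖ + 1 : ℝ) : ℂ)).norm
      (fun m => (differentiable_struveTerm n m).differentiableOn) Metric.isOpen_ball
      (fun m w hw => norm_struveTerm_le n m (mem_ball_zero_iff.mp hw).le)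
  exact h.differentiableAt (Metric.isOpen_ball.mem_nhds (by simp))

theorem hasDerivAt_struveH (n : ℕ) {z : ℂ} (hz : z ≠ 0) :
    HasDerivAt (struveH n) (n / z * struveH n z + (struveInhom n z - struveH (n + 1) z)) z := by
  have h : HasSum (fun m => deriv (struveTerm n m) z)
      (deriv (fun w => ∑' m, struveTerm n m w) z) :=
    Complex.hasSum_deriv_of_summable_norm
      (summable_struveTerm n ((‖z‖ + 1 : ℝ) : ℂ)).norm
      (fun m => (differentiable_struveTerm n m).differentiableOn) Metric.isOpen_ball
      (fun m w hw => norm_struveTerm_le n m (mem_ball_zero_iff.mp hw).le)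
      (by simp : z ∈ Metric.ball 0 (‖z‖ + 1))
  refine (differentiable_struveH n z).hasDerivAt.congr_deriv ?_
  refine HasSum.unique h ?_
  exact (((hasSum_struveH n z).mul_left (n / z)).add (hasSum_struve_shift n z)).congr_fun
    fun m => (hasDerivAt_struveTerm n m hz).deriv

theorem analyticAt_struveH_div (n : ℕ) {z : ℂ} (hz : z ≠ 0) :
    AnalyticAt ℂ (fun w => struveH n w / w) z :=
  ((differentiable_struveH n).analyticAt z).div analyticAt_id hz

/-! ### The derivatives in terms of Struve functions of higher order -/

/-- A partial sum of the Gauss sum in `factorial_mul_sum_hermiteCoeff_Gamma`, at `y = 1 / 2 - j`: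
the terms in which the argument of the Gamma function is at most `1 / 2`. -/
noncomputable def gaussPartial (k j : ℕ) : ℂ :=
  ∑ i ∈ Finset.range (j + 1), hermiteCoeff k i * ((1 / 4) ^ i * (Complex.Gamma (1 / 2 - j + i))⁻¹)

theorem gaussPartial_succ_zero (k : ℕ) :
    ((k : ℂ) + 1) * gaussPartial (k + 1) 0 = hermiteCoeff k 0 / (Real.sqrt Real.pi : ℂ) := by
  simp only [gaussPartial, zero_add, Finset.sum_range_one, ← mul_assoc,
    succ_mul_hermiteCoeff_succ_zero]
  simp [← Gamma_half, div_eq_mul_inv]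

theorem gaussPartial_succ_succ (k j : ℕ) :
    ((k : ℂ) + 1) * gaussPartial (k + 1) (j + 1) =
      hermiteCoeff k (j + 1) * (1 / 4) ^ (j + 1) / (Real.sqrt Real.pi : ℂ) +
        ((k - 1) / 2 - j) * gaussPartial k j := by
  have h1 : (1 / 2 - ((j + 1 : ℕ) : ℂ) + ((j + 1 : ℕ) : ℂ)) = 1 / 2 := by ring
  rw [gaussPartial, succ_mul_sum_hermiteCoeff, Finset.sum_range_succ, h1, Gamma_half,
    add_comm (Finset.sum _ _), add_assoc, ← Finset.sum_add_distrib, gaussPartial, Finset.mul_sum]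
  congr 1
  · ring
  · refine Finset.sum_congr rfl fun i _ => ?_
    rw [inv_Gamma_eq (1 / 2 - ((j + 1 : ℕ) : ℂ) + i),
      show (1 / 2 - ((j + 1 : ℕ) : ℂ) + i + 1) = 1 / 2 - j + i by push_cast; ring,
      show (1 / 2 - ((j + 1 : ℕ) : ℂ) + ((i + 1 : ℕ) : ℂ)) = 1 / 2 - j + i by push_cast; ring]
    push_cast
    ring

/-- Once the partial sum contains all nonzero terms, Gauss's theorem evaluates it. -/
theorem factorial_mul_gaussPartial {k j : ℕ} (h1 : k < 2 * (j + 1)) (h2 : j ≤ k) :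
    (k.factorial : ℂ) * gaussPartial k j =
      (∏ l ∈ Finset.range k, ((2 * (k : ℂ) - 2 * j - 1 - l) / 2)) *
        (Complex.Gamma (1 / 2 - j + k))⁻¹ := by
  have h : gaussPartial k j = ∑ i ∈ Finset.range (k + 1),
      hermiteCoeff k i * ((1 / 4) ^ i * (Complex.Gamma (1 / 2 - j + i))⁻¹) := by
    refine Finset.sum_subset (Finset.range_mono (by omega)) fun i _ hi => ?_
    rw [Finset.mem_range, not_lt] at hi
    rw [hermiteCoeff_eq_zero (by omega), zero_mul]
  rw [h, factorial_mul_sum_hermiteCoeff_Gamma]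
  congr 1
  exact Finset.prod_congr rfl fun l _ => by ring

theorem gaussPartial_eq_zero {k j : ℕ} (h1 : k ≤ 2 * j) (h2 : j < k) : gaussPartial k j = 0 := by
  have h := factorial_mul_gaussPartial (k := k) (j := j) (by omega) h2.le
  have h0 : ∏ l ∈ Finset.range k, ((2 * (k : ℂ) - 2 * j - 1 - l) / 2) = 0 := by
    refine Finset.prod_eq_zero (Finset.mem_range.mpr (by omega : 2 * k - 2 * j - 1 < k)) ?_
    rw [show 2 * k - 2 * j - 1 = 2 * k - (2 * j + 1) by omega,
      Nat.cast_sub (by omega : 2 * j + 1 ≤ 2 * k)]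
    push_cast
    ring
  rw [h0, zero_mul] at h
  exact (mul_eq_zero.mp h).resolve_left (by exact_mod_cast k.factorial_ne_zero)

theorem factorial_mul_gaussPartial_odd (j : ℕ) :
    (((2 * j + 1).factorial : ℕ) : ℂ) * gaussPartial (2 * j + 1) j =
      ((2 * j + 1).factorial : ℂ) * ((1 / 2) ^ (2 * j + 1) * (Complex.Gamma (j + 3 / 2))⁻¹) := by
  rw [factorial_mul_gaussPartial (by omega) (by omega),
    show (1 / 2 - (j : ℂ) + (2 * j + 1 : ℕ)) = j + 3 / 2 by push_cast; ring, ← mul_assoc]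
  congr 1
  rw [← Finset.prod_range_reflect, ← Finset.prod_range_add_one_eq_factorial, Nat.cast_prod,
    ← Finset.card_range (2 * j + 1), ← Finset.prod_const, Finset.card_range,
    ← Finset.prod_mul_distrib]
  refine Finset.prod_congr rfl fun l hl => ?_
  have hl' := Finset.mem_range.mp hl
  rw [show 2 * j + 1 - 1 - l = 2 * j - l by omega, Nat.cast_sub (by omega : l ≤ 2 * j)]
  push_cast
  ring

theorem gaussPartial_odd (j : ℕ) :
    gaussPartial (2 * j + 1) j = (1 / 2) ^ (2 * j + 1) * (Complex.Gamma (j + 3 / 2))⁻¹ :=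
  mul_left_cancel₀ (by exact_mod_cast (2 * j + 1).factorial_ne_zero)
    (factorial_mul_gaussPartial_odd j)

/-- The coefficient of `(z / 2) ^ (k - 1 - 2 j)` in `elementaryPart k z`. -/
noncomputable def elementaryCoeff (k j : ℕ) : ℂ :=
  (-1) ^ j * (Complex.Gamma (k + 3 / 2 - j))⁻¹ * (1 / 2 * gaussPartial k j)

/-- The elementary part, with the summation extended to `j < k`. The added coefficients vanish,
except that for `k = 0` the sum is empty, which makes the formula for the `k`-th derivative
correct for `k = 0`, too. -/
noncomputable def elementarySum (k : ℕ) (z : ℂ) : ℂ :=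
  ∑ j ∈ Finset.range k, elementaryCoeff k j * (z / 2) ^ ((k : ℤ) - 1 - 2 * j)

theorem elementaryCoeff_eq_zero {k j : ℕ} (h1 : k ≤ 2 * j) (h2 : j < k) :
    elementaryCoeff k j = 0 := by
  rw [elementaryCoeff, gaussPartial_eq_zero h1 h2, mul_zero, mul_zero]

theorem elementaryPart_eq_elementarySum {k : ℕ} (hk : 1 ≤ k) (z : ℂ) :
    elementaryPart k z = elementarySum k z := by
  have h : elementarySum k z = ∑ j ∈ Finset.range (k / 2 + 1),
      elementaryCoeff k j * (z / 2) ^ ((k : ℤ) - 1 - 2 * j) := by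
    refine (Finset.sum_subset (Finset.range_mono (by omega)) fun j hj hj' => ?_).symm
    rw [Finset.mem_range] at hj hj'
    rw [elementaryCoeff_eq_zero (by omega) hj, zero_mul]
  rw [h, elementaryPart]
  refine Finset.sum_congr rfl fun j hj => ?_
  rw [elementaryCoeff, gaussPartial, div_mul_eq_mul_div, div_eq_mul_inv, Finset.mul_sum,
    Finset.mul_sum, Finset.mul_sum, Finset.sum_mul, Finset.sum_mul]
  refine Finset.sum_congr rfl fun i hi => ?_
  rw [Finset.mem_range] at hi hj
  rw [hermiteCoeff_eq (by omega), pow_succ, pow_mul,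
    show (i : ℂ) + 1 / 2 - j = 1 / 2 - j + i by ring,
    show ((1 / 2 : ℂ) ^ 2) = 1 / 4 by norm_num]
  simp only [div_eq_mul_inv, mul_inv, one_mul]
  ring

theorem exists_polynomial_elementaryPart {k : ℕ} (hk : 1 ≤ k) :
    ∃ p : Polynomial ℂ, ∀ z : ℂ, elementaryPart k z = p.eval z := by
  refine ⟨∑ j ∈ Finset.range k, Polynomial.C (elementaryCoeff k j) * halfPow (k - 1 - 2 * j),
    fun z => ?_⟩
  rw [elementaryPart_eq_elementarySum hk, elementarySum, Polynomial.eval_finsetSum]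
  refine Finset.sum_congr rfl fun j hj => ?_
  rw [Finset.mem_range] at hj
  rcases Nat.lt_or_ge (2 * j) k with h | h
  · rw [show (k : ℤ) - 1 - 2 * j = ((k - 1 - 2 * j : ℕ) : ℤ) by omega, zpow_natCast]
    simp only [halfPow, Polynomial.eval_mul, Polynomial.eval_C, Polynomial.eval_pow,
      Polynomial.eval_X]
    ring
  · simp [elementaryCoeff_eq_zero h hj]

theorem succ_mul_elementaryCoeff_succ_zero (k : ℕ) :
    ((k : ℂ) + 1) * elementaryCoeff (k + 1) 0 = hermiteCoeff k 0 / 2 /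
      ((Real.sqrt Real.pi : ℂ) * Complex.Gamma (k + 1 + 3 / 2)) := by
  have h := gaussPartial_succ_zero k
  rw [elementaryCoeff]
  push_cast
  rw [sub_zero, pow_zero, one_mul, mul_left_comm, mul_left_comm _ (1 / 2 : ℂ), h]
  simp only [div_eq_mul_inv, mul_inv]
  ring

theorem succ_mul_elementaryCoeff_succ_succ (k j : ℕ) :
    ((k : ℂ) + 1) * elementaryCoeff (k + 1) (j + 1) =
      (-1) ^ (j + 1) * hermiteCoeff k (j + 1) * (1 / 4) ^ (j + 1) / 2 /
      ((Real.sqrt Real.pi : ℂ) * Complex.Gamma (k + 3 / 2 - j)) -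
        elementaryCoeff k j * ((k - 1 - 2 * j) / 2) := by
  have h := gaussPartial_succ_succ k j
  rw [elementaryCoeff, elementaryCoeff,
    show ((k + 1 : ℕ) : ℂ) + 3 / 2 - (j + 1 : ℕ) = k + 3 / 2 - j by push_cast; ring,
    mul_left_comm, mul_left_comm _ (1 / 2 : ℂ), h]
  simp only [div_eq_mul_inv, mul_inv]
  ring

theorem hasDerivAt_half_zpow (n : ℤ) {z : ℂ} (hz : z ≠ 0) :
    HasDerivAt (fun w : ℂ => (w / 2) ^ n) (n / 2 * (z / 2) ^ (n - 1)) z := by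
  have h := (hasDerivAt_zpow n (z / 2) (Or.inl (div_ne_zero hz two_ne_zero))).comp z
    ((hasDerivAt_id z).div_const 2)
  exact h.congr_deriv (by ring)

/-- The elementary sum absorbs the inhomogeneous terms which arise when the Struve functions in the
formula for the `k`-th derivative are differentiated. -/
theorem hasDerivAt_elementarySum (k : ℕ) {z : ℂ} (hz : z ≠ 0) :
    HasDerivAt (elementarySum k)
      (2 * ∑ i ∈ Finset.range (k + 1), (-1) ^ i * hermiteCoeff k i *
        (struveInhom (k + 1 - i) z / (2 * z) ^ (i + 1)) -
        (k + 1) * elementarySum (k + 1) z) z := by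
  have h : HasDerivAt (elementarySum k) (∑ j ∈ Finset.range k, elementaryCoeff k j *
      ((((k : ℤ) - 1 - 2 * j : ℤ) : ℂ) / 2 * (z / 2) ^ ((k : ℤ) - 1 - 2 * j - 1))) z :=
    HasDerivAt.fun_sum fun j _ => (hasDerivAt_half_zpow _ hz).const_mul _
  refine h.congr_deriv ?_
  have hw : z / 2 ≠ 0 := div_ne_zero hz two_ne_zero
  have hs : ∀ i ∈ Finset.range (k + 1), (-1) ^ i * hermiteCoeff k i *
      (struveInhom (k + 1 - i) z / (2 * z) ^ (i + 1)) = (-1) ^ i * hermiteCoeff k i *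
      (1 / 4) ^ (i + 1) / ((Real.sqrt Real.pi : ℂ) * Complex.Gamma (k + 1 + 3 / 2 - i)) *
      (z / 2) ^ ((k : ℤ) - 2 * i) := fun i hi => by
    have hi' : i ≤ k + 1 := (Finset.mem_range.mp hi).le
    rw [struveInhom, Nat.cast_sub hi', ← zpow_natCast (z / 2), Nat.cast_sub hi',
      show (2 * z : ℂ) = 4 * (z / 2) by ring, mul_pow, ← zpow_natCast (z / 2) (i + 1),
      show (k : ℤ) - 2 * i = ((k + 1 : ℕ) - (i : ℤ)) - ((i + 1 : ℕ) : ℤ) by push_cast; ring,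
      zpow_sub₀ hw _ ((i + 1 : ℕ) : ℤ)]
    push_cast
    rw [show (k : ℂ) + 1 - i + 3 / 2 = k + 1 + 3 / 2 - i by ring, one_div, inv_pow]
    simp only [div_eq_mul_inv, mul_inv]
    ring
  rw [Finset.sum_congr rfl hs, elementarySum, Finset.sum_range_succ', Finset.sum_range_succ',
    mul_add, mul_add, ← mul_assoc _ (elementaryCoeff _ _), succ_mul_elementaryCoeff_succ_zero,
    Finset.mul_sum, Finset.mul_sum]
  have hd : ∀ j ∈ Finset.range k, elementaryCoeff k j *
      ((((k : ℤ) - 1 - 2 * j : ℤ) : ℂ) / 2 * (z / 2) ^ ((k : ℤ) - 1 - 2 * j - 1)) =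
      2 * ((-1) ^ (j + 1) * hermiteCoeff k (j + 1) *
      (1 / 4) ^ (j + 1 + 1) /
        ((Real.sqrt Real.pi : ℂ) * Complex.Gamma (k + 1 + 3 / 2 - (j + 1 : ℕ))) *
        (z / 2) ^ ((k : ℤ) - 2 * (j + 1 : ℕ))) -
      ((k : ℂ) + 1) * (elementaryCoeff (k + 1) (j + 1) *
        (z / 2) ^ (((k + 1 : ℕ) : ℤ) - 1 - 2 * (j + 1 : ℕ))) := fun j _ => by
    rw [← mul_assoc ((k : ℂ) + 1), succ_mul_elementaryCoeff_succ_succ,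
      show ((k + 1 : ℕ) : ℤ) - 1 - 2 * (j + 1 : ℕ) = k - 2 * (j + 1 : ℕ) by push_cast; ring,
      show (k : ℤ) - 1 - 2 * j - 1 = k - 2 * (j + 1 : ℕ) by push_cast; ring,
      show (k : ℂ) + 1 + 3 / 2 - (j + 1 : ℕ) = k + 3 / 2 - j by push_cast; ring]
    push_cast
    ring
  rw [Finset.sum_congr rfl hd, Finset.sum_sub_distrib]
  push_cast
  simp only [sub_zero, add_sub_cancel_right]
  ring

theorem hasDerivAt_struveH_div_pow (n i : ℕ) {z : ℂ} (hz : z ≠ 0) :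
    HasDerivAt (fun w => struveH n w / (2 * w) ^ (i + 1))
      (2 * ((n : ℂ) - i - 1) * (struveH n z / (2 * z) ^ (i + 2)) -
        struveH (n + 1) z / (2 * z) ^ (i + 1) + struveInhom n z / (2 * z) ^ (i + 1)) z := by
  have h := (hasDerivAt_struveH n hz).div (((hasDerivAt_id z).const_mul 2).pow (i + 1))
    (pow_ne_zero _ (mul_ne_zero two_ne_zero hz))
  refine h.congr_deriv ?_
  simp only [id, Pi.pow_apply, add_tsub_cancel_right]
  push_cast
  field_simp
  ring

theorem iteratedDeriv_struveH_div (k : ℕ) {z : ℂ} (hz : z ≠ 0) :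
    iteratedDeriv k (fun w => struveH 1 w / w) z = (k.factorial : ℂ) * (-1) ^ k *
      (2 * ∑ i ∈ Finset.range (k + 1), (-1) ^ i * hermiteCoeff k i *
        (struveH (k + 1 - i) z / (2 * z) ^ (i + 1)) - elementarySum k z) := by
  induction k generalizing z with
  | zero =>
    simp [hermiteCoeff, recipFact, elementarySum]
    field_simp
  | succ k ih =>
    have hev : iteratedDeriv k (fun w => struveH 1 w / w) =ᶠ[nhds z] fun w =>
        (k.factorial : ℂ) * (-1) ^ k *
          (2 * ∑ i ∈ Finset.range (k + 1), (-1) ^ i * hermiteCoeff k i *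
            (struveH (k + 1 - i) w / (2 * w) ^ (i + 1)) - elementarySum k w) := by
      filter_upwards [isOpen_ne.mem_nhds hz] with w hw using ih hw
    have hd : HasDerivAt (fun w => (k.factorial : ℂ) * (-1) ^ k *
          (2 * ∑ i ∈ Finset.range (k + 1), (-1) ^ i * hermiteCoeff k i *
            (struveH (k + 1 - i) w / (2 * w) ^ (i + 1)) - elementarySum k w)) _ z :=
      (((HasDerivAt.fun_sum fun i _ => (hasDerivAt_struveH_div_pow (k + 1 - i) i hz).const_mul
        ((-1) ^ i * hermiteCoeff k i)).const_mul 2).sub (hasDerivAt_elementarySum k hz)).const_mul _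
    rw [iteratedDeriv_succ, hev.deriv_eq, hd.deriv]
    have key := succ_mul_sum_hermiteCoeff_full k
      fun i => (-1) ^ i * (struveH (k + 1 + 1 - i) z / (2 * z) ^ (i + 1))
    have e : ∀ i ∈ Finset.range (k + 1), (-1) ^ i * hermiteCoeff k i *
        (2 * (((k + 1 - i : ℕ) : ℂ) - i - 1) * (struveH (k + 1 - i) z / (2 * z) ^ (i + 2)) -
        struveH (k + 1 - i + 1) z / (2 * z) ^ (i + 1) +
          struveInhom (k + 1 - i) z / (2 * z) ^ (i + 1)) =
        -(hermiteCoeff k i * ((-1) ^ i * (struveH (k + 1 + 1 - i) z / (2 * z) ^ (i + 1)) +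
          2 * ((k : ℂ) - 2 * i) * ((-1) ^ (i + 1) *
            (struveH (k + 1 + 1 - (i + 1)) z / (2 * z) ^ (i + 1 + 1))))) +
        (-1) ^ i * hermiteCoeff k i * (struveInhom (k + 1 - i) z / (2 * z) ^ (i + 1)) := by
      intro i hi
      have hi' : i ≤ k := Nat.lt_succ_iff.mp (Finset.mem_range.mp hi)
      rw [show k + 1 + 1 - (i + 1) = k + 1 - i by omega,
        show k + 1 + 1 - i = k + 1 - i + 1 by omega, Nat.cast_sub (by omega : i ≤ k + 1)]
      push_cast
      ring
    rw [Finset.sum_congr rfl e, Finset.sum_add_distrib, Finset.sum_neg_distrib, ← key,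
      Nat.factorial_succ]
    have e2 : ∑ i ∈ Finset.range (k + 1 + 1), (-1) ^ i * hermiteCoeff (k + 1) i *
        (struveH (k + 1 + 1 - i) z / (2 * z) ^ (i + 1)) =
        ∑ i ∈ Finset.range (k + 2), hermiteCoeff (k + 1) i *
        ((-1) ^ i * (struveH (k + 1 + 1 - i) z / (2 * z) ^ (i + 1))) :=
      Finset.sum_congr rfl fun i _ => by ring
    rw [e2]
    push_cast
    ring

/-! ### Lommel polynomials and the reduction to the orders zero and one -/

theorem sum_range_eq_sum_range {M N : ℕ} {f : ℕ → ℂ} (hM : ∀ i, M ≤ i → f i = 0)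
    (hN : ∀ i, N ≤ i → f i = 0) : ∑ i ∈ Finset.range M, f i = ∑ i ∈ Finset.range N, f i := by
  rcases le_total M N with h | h
  · exact (Finset.eventually_constant_sum hM h).symm
  · exact Finset.eventually_constant_sum hN h

/-- The coefficient of `(z / 2) ^ (2 κ - j)` in `lommelC ν z j`, for `j < ν`. -/
noncomputable def lommelCoeff (ν j κ : ℕ) : ℂ :=
  (-1) ^ κ / (κ.factorial : ℂ) * (intFact ((j : ℤ) - κ) * recipFact ((j : ℤ) - 2 * κ)) *
    (intFact ((ν : ℤ) - 1 - κ) * recipFact ((ν : ℤ) - 1 - j + κ))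

theorem lommelCoeff_eq_zero {ν j κ : ℕ} (h : j < 2 * κ) : lommelCoeff ν j κ = 0 := by
  rw [lommelCoeff, recipFact_of_neg (by omega : (j : ℤ) - 2 * κ < 0), mul_zero, mul_zero, zero_mul]

theorem intFact_mul_recipFact_self {n : ℤ} (hn : 0 ≤ n) : intFact n * recipFact n = 1 := by
  lift n to ℕ using hn
  rw [intFact_natCast, recipFact_natCast]
  exact mul_one_div_cancel (by exact_mod_cast n.factorial_ne_zero)

theorem lommelCoeff_zero (ν j : ℕ) :
    lommelCoeff ν j 0 = intFact ((ν : ℤ) - 1) * recipFact ((ν : ℤ) - 1 - j) := by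
  simp [lommelCoeff, intFact_mul_recipFact_self]

theorem lommelCoeff_succ_zero (ν j : ℕ) :
    lommelCoeff ν (j + 1) 0 = ((ν : ℂ) - (j + 1)) * lommelCoeff ν j 0 := by
  have h1 := recipFact_eq_succ_mul ((ν : ℤ) - 1 - (j + 1))
  rw [show (ν : ℤ) - 1 - (j + 1) + 1 = ν - 1 - j by ring] at h1
  rw [lommelCoeff_zero, lommelCoeff_zero]
  push_cast at h1 ⊢
  rw [h1]
  ring

theorem lommelCoeff_succ_succ {ν j : ℕ} (h : j + 2 < ν) (κ : ℕ) :
    lommelCoeff ν (j + 2) (κ + 1) =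
      ((ν : ℂ) - (j + 2)) * lommelCoeff ν (j + 1) (κ + 1) - lommelCoeff ν j κ := by
  rcases Nat.lt_or_ge j (2 * κ) with hκ | hκ
  · rw [lommelCoeff_eq_zero hκ, lommelCoeff_eq_zero (by omega), lommelCoeff_eq_zero (by omega)]
    ring
  -- write all three coefficients with the same four factorials
  have h1 := recipFact_eq_succ_mul ((j : ℤ) - 2 * κ - 1)
  have h2 := intFact_succ (show 0 ≤ (j : ℤ) - κ by omega)
  have h3 := intFact_succ (show 0 ≤ (ν : ℤ) - 2 - κ by omega)
  have h4 := recipFact_eq_succ_mul ((ν : ℤ) - 2 - j + κ)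
  have hκ0 : (κ.factorial : ℂ) ≠ 0 := by exact_mod_cast κ.factorial_ne_zero
  have hκ1 : (κ : ℂ) + 1 ≠ 0 := by exact_mod_cast κ.succ_ne_zero
  rw [show (j : ℤ) - 2 * κ - 1 + 1 = j - 2 * κ by ring] at h1
  rw [show (ν : ℤ) - 2 - κ + 1 = ν - 1 - κ by ring] at h3
  rw [show (ν : ℤ) - 2 - j + κ + 1 = ν - 1 - j + κ by ring] at h4
  simp only [lommelCoeff, Nat.factorial_succ, pow_succ]
  push_cast at h1 h2 h3 h4 ⊢
  rw [show (j : ℤ) + 2 - (κ + 1) = j - κ + 1 by ring,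
    show (j : ℤ) + 2 - 2 * (κ + 1) = j - 2 * κ by ring,
    show (ν : ℤ) - 1 - (κ + 1) = ν - 2 - κ by ring,
    show (ν : ℤ) - 1 - (j + 2) + (κ + 1) = ν - 2 - j + κ by ring,
    show (j : ℤ) + 1 - (κ + 1) = j - κ by ring,
    show (j : ℤ) + 1 - 2 * (κ + 1) = j - 2 * κ - 1 by ring,
    show (ν : ℤ) - 1 - (j + 1) + (κ + 1) = ν - 1 - j + κ by ring, h1, h2, h3, h4]
  field_simp
  ring

theorem lommelC_eq_sum {ν j : ℕ} (hj : j < ν) {z : ℂ} (hz : z ≠ 0) :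
    lommelC ν z j =
      ∑ κ ∈ Finset.range (j + 1), lommelCoeff ν j κ * (z / 2) ^ (2 * (κ : ℤ) - j) := by
  have hw : z / 2 ≠ 0 := div_ne_zero hz two_ne_zero
  induction j using Nat.twoStepInduction with
  | zero =>
    rw [lommelC, Finset.sum_range_one, lommelCoeff_zero]
    simp only [Nat.cast_zero, sub_zero, mul_zero, zpow_zero, mul_one]
    exact (intFact_mul_recipFact_self (by omega)).symm
  | one =>
    have h1 := lommelCoeff_succ_zero ν 0
    rw [lommelCoeff_zero ν 0, Nat.cast_zero, Nat.cast_zero, sub_zero,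
      intFact_mul_recipFact_self (by omega), zero_add, zero_add] at h1
    rw [lommelC, Finset.sum_range_succ, Finset.sum_range_one,
      lommelCoeff_eq_zero (by omega : 1 < 2 * 1), h1]
    simp
    field_simp
  | more j ih1 ih2 =>
    rw [lommelC, ih1 (by omega), ih2 (by omega), Finset.sum_range_succ' _ (j + 2),
      lommelCoeff_succ_zero, Finset.sum_range_succ' _ (j + 1), mul_add, Finset.mul_sum]
    have e1 : ∑ κ ∈ Finset.range (j + 1), 2 * ((ν : ℂ) - ((j : ℂ) + 2)) / z *
        (lommelCoeff ν (j + 1) (κ + 1) * (z / 2) ^ (2 * ((κ + 1 : ℕ) : ℤ) - (j + 1 : ℕ))) =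
        ∑ κ ∈ Finset.range (j + 2), ((ν : ℂ) - ((j : ℂ) + 2)) *
        lommelCoeff ν (j + 1) (κ + 1) * (z / 2) ^ (2 * ((κ + 1 : ℕ) : ℤ) - (j + 2 : ℕ)) := by
      rw [Finset.sum_range_succ _ (j + 1), lommelCoeff_eq_zero (by omega), mul_zero, zero_mul,
        add_zero]
      refine Finset.sum_congr rfl fun κ _ => ?_
      rw [show 2 * ((κ + 1 : ℕ) : ℤ) - (j + 1 : ℕ) = 2 * ((κ + 1 : ℕ) : ℤ) - (j + 2 : ℕ) + 1 by
        push_cast; ring, zpow_add_one₀ hw]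
      field_simp
    have e2 : ∑ κ ∈ Finset.range (j + 1), lommelCoeff ν j κ * (z / 2) ^ (2 * (κ : ℤ) - j) =
        ∑ κ ∈ Finset.range (j + 2), lommelCoeff ν j κ *
          (z / 2) ^ (2 * ((κ + 1 : ℕ) : ℤ) - (j + 2 : ℕ)) := by
      rw [Finset.sum_range_succ _ (j + 1), lommelCoeff_eq_zero (by omega : j < 2 * (j + 1)),
        zero_mul, add_zero]
      refine Finset.sum_congr rfl fun κ _ => ?_
      rw [show 2 * ((κ + 1 : ℕ) : ℤ) - (j + 2 : ℕ) = 2 * (κ : ℤ) - j by push_cast; ring]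
    rw [e1, e2, add_sub_right_comm, ← Finset.sum_sub_distrib]
    congr 1
    · refine Finset.sum_congr rfl fun κ _ => ?_
      rw [lommelCoeff_succ_succ hj]
      ring
    · rw [show 2 * ((0 : ℕ) : ℤ) - (j + 1 : ℕ) = 2 * ((0 : ℕ) : ℤ) - (j + 2 : ℕ) + 1 by
        push_cast; ring, zpow_add_one₀ hw]
      push_cast
      field_simp
      ring

/-- Iterating the three-term recurrence downwards from the order `j + 2 + p`. -/
theorem struveH_eq_lommelC (j p : ℕ) {z : ℂ} (hz : z ≠ 0) {ν : ℕ} (hν : ν = j + 2 + p) :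
    struveH ν z = lommelC ν z (j + 1) * struveH (p + 1) z - lommelC ν z j * struveH p z +
      ∑ l ∈ Finset.range (j + 1), struveInhom (ν - 1 - l) z * lommelC ν z l := by
  induction j generalizing p with
  | zero =>
    have h := struveH_sub p hz
    rw [Finset.sum_range_one, hν, lommelC, lommelC, show 0 + 2 + p - 1 - 0 = p + 1 by omega,
      show 0 + 2 + p = p + 2 by omega]
    push_cast
    linear_combination h
  | succ j ih =>
    have h := struveH_sub p hz
    rw [ih (p + 1) (by omega), Finset.sum_range_succ _ (j + 1), lommelC,
      show ν - 1 - (j + 1) = p + 1 by omega,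
      show (ν : ℂ) - (j + 2) = p + 1 by rw [hν]; push_cast; ring]
    linear_combination lommelC ν z (j + 1) * h

theorem struveS_eq (ν : ℕ) (z : ℂ) :
    struveS ν z = ∑ l ∈ Finset.range (ν - 1), struveInhom (ν - 1 - l) z * lommelC ν z l := by
  rw [struveS, Finset.mul_sum]
  refine Finset.sum_congr rfl fun l hl => ?_
  have hl' := Finset.mem_range.mp hl
  rw [struveInhom, show ν - 1 - l = ν - (1 + l) by omega, Nat.cast_sub (by omega : 1 + l ≤ ν),
    show (ν : ℂ) - ((1 + l : ℕ) : ℂ) + 3 / 2 = ν + 1 / 2 - l by push_cast; ring]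
  simp only [div_eq_mul_inv, mul_inv]
  ring

/-- The coefficient of `(z / 2) ^ (2 κ + 1 - n) * 𝐇₁(z)` in the reduction of `𝐇_n(z)`. -/
noncomputable def reductionCoeffOne (n κ : ℕ) : ℂ :=
  (-1) ^ κ / (κ.factorial : ℂ) ^ 2 *
    (intFact ((n : ℤ) - 1 - κ) ^ 2 * recipFact ((n : ℤ) - 1 - 2 * κ))

/-- The coefficient of `-(z / 2) ^ (2 κ + 2 - n) * 𝐇₀(z)` in the reduction of `𝐇_n(z)`. -/
noncomputable def reductionCoeffZero (n κ : ℕ) : ℂ :=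
  (-1) ^ κ / ((κ.factorial : ℂ) * ((κ + 1).factorial : ℂ)) *
    (intFact ((n : ℤ) - 1 - κ) * intFact ((n : ℤ) - 2 - κ) * recipFact ((n : ℤ) - 2 - 2 * κ))

theorem reductionCoeffOne_eq_zero {n κ : ℕ} (h : n ≤ 2 * κ) : reductionCoeffOne n κ = 0 := by
  rw [reductionCoeffOne, recipFact_of_neg (by omega), mul_zero, mul_zero]

theorem reductionCoeffZero_eq_zero {n κ : ℕ} (h : n ≤ 2 * κ + 1) : reductionCoeffZero n κ = 0 := by
  rw [reductionCoeffZero, recipFact_of_neg (by omega), mul_zero, mul_zero]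

theorem lommelCoeff_eq_reductionCoeffOne (j κ : ℕ) :
    lommelCoeff (j + 2) (j + 1) κ = reductionCoeffOne (j + 2) κ := by
  rw [lommelCoeff, reductionCoeffOne]
  push_cast
  rw [show (j : ℤ) + 2 - 1 - (j + 1) + κ = κ by ring, recipFact_natCast,
    show (j : ℤ) + 2 - 1 - κ = j + 1 - κ by ring,
    show (j : ℤ) + 2 - 1 - 2 * κ = j + 1 - 2 * κ by ring]
  simp only [div_eq_mul_inv]
  ring

theorem lommelCoeff_eq_reductionCoeffZero (j κ : ℕ) :
    lommelCoeff (j + 2) j κ = reductionCoeffZero (j + 2) κ := by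
  rw [lommelCoeff, reductionCoeffZero]
  push_cast
  rw [show (j : ℤ) + 2 - 1 - j + κ = (κ + 1 : ℕ) by push_cast; ring, recipFact_natCast,
    show (j : ℤ) + 2 - 2 - κ = j - κ by ring,
    show (j : ℤ) + 2 - 2 - 2 * κ = j - 2 * κ by ring]
  simp only [div_eq_mul_inv, mul_inv]
  ring

theorem struveH_eq_reduction {n K : ℕ} (hn : 1 ≤ n) (hK : n ≤ 2 * K) {z : ℂ} (hz : z ≠ 0) :
    struveH n z =
      (∑ κ ∈ Finset.range K, reductionCoeffOne n κ * (z / 2) ^ (2 * (κ : ℤ) + 1 - n)) *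
          struveH 1 z -
        (∑ κ ∈ Finset.range K, reductionCoeffZero n κ * (z / 2) ^ (2 * (κ : ℤ) + 2 - n)) *
          struveH 0 z + struveS n z := by
  rcases Nat.lt_or_ge n 2 with h | h
  · obtain rfl : n = 1 := by omega
    have h1 : ∑ κ ∈ Finset.range K, reductionCoeffOne 1 κ * (z / 2) ^ (2 * (κ : ℤ) + 1 - (1 : ℕ)) =
        ∑ κ ∈ Finset.range 1, reductionCoeffOne 1 κ * (z / 2) ^ (2 * (κ : ℤ) + 1 - (1 : ℕ)) :=
      sum_range_eq_sum_range
        (fun κ hκ => by rw [reductionCoeffOne_eq_zero (by omega), zero_mul])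
        (fun κ hκ => by rw [reductionCoeffOne_eq_zero (by omega), zero_mul])
    have h2 : ∑ κ ∈ Finset.range K, reductionCoeffZero 1 κ *
        (z / 2) ^ (2 * (κ : ℤ) + 2 - (1 : ℕ)) = 0 :=
      Finset.sum_eq_zero fun κ _ => by rw [reductionCoeffZero_eq_zero (by omega), zero_mul]
    rw [h1, h2]
    simp [reductionCoeffOne, struveS, intFact, recipFact]
  · obtain ⟨j, rfl⟩ := Nat.exists_eq_add_of_le' h
    rw [struveH_eq_lommelC j 0 hz rfl, struveS_eq, lommelC_eq_sum (by omega) hz,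
      lommelC_eq_sum (by omega : j < j + 2) hz]
    congr 3
    · refine (Finset.sum_congr rfl fun κ _ => ?_).trans (sum_range_eq_sum_range
        (f := fun κ => reductionCoeffOne (j + 2) κ * (z / 2) ^ (2 * (κ : ℤ) + 1 - (j + 2 : ℕ)))
        (fun κ hκ => by rw [reductionCoeffOne_eq_zero (by omega), zero_mul])
        (fun κ hκ => by rw [reductionCoeffOne_eq_zero (by omega), zero_mul]))
      rw [lommelCoeff_eq_reductionCoeffOne]
      congr 2
      push_cast
      ring
    · refine (Finset.sum_congr rfl fun κ _ => ?_).trans (sum_range_eq_sum_range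
        (f := fun κ => reductionCoeffZero (j + 2) κ * (z / 2) ^ (2 * (κ : ℤ) + 2 - (j + 2 : ℕ)))
        (fun κ hκ => by rw [reductionCoeffZero_eq_zero (by omega), zero_mul])
        (fun κ hκ => by rw [reductionCoeffZero_eq_zero (by omega), zero_mul]))
      rw [lommelCoeff_eq_reductionCoeffZero]
      congr 2
      push_cast
      ring

theorem prefactorH1_eq {k : ℕ} (hk : 1 ≤ k) (z : ℂ) :
    prefactorH1 k z = 1 / 2 * ∑ i ∈ Finset.range (k + 1), (-1 / 4) ^ i * hermiteCoeff k i *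
      ∑ κ ∈ Finset.range (k + 1), reductionCoeffOne (k + 1 - i) κ *
        (z / 2) ^ (2 * (κ : ℤ) - k - 1) := by
  rw [sum_range_eq_sum_range (M := k + 1) (N := (k + 1) / 2 + 1)
    (fun i hi => by rw [hermiteCoeff_eq_zero (by omega), mul_zero, zero_mul])
    (fun i hi => by rw [hermiteCoeff_eq_zero (by omega), mul_zero, zero_mul]),
    prefactorH1, Finset.mul_sum]
  refine Finset.sum_congr rfl fun i hi => ?_
  have hi' := Finset.mem_range.mp hi
  rw [sum_range_eq_sum_range (M := k + 1) (N := (k - i + 1) / 2 + 1)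
    (fun κ hκ => by rw [reductionCoeffOne_eq_zero (by omega), zero_mul])
    (fun κ hκ => by rw [reductionCoeffOne_eq_zero (by omega), zero_mul])]
  have e : ∀ κ ∈ Finset.range ((k - i + 1) / 2 + 1),
      Complex.Gamma (k + 1 - i - κ) ^ 2 / Complex.Gamma (k + 1 - i - 2 * κ) *
          ((-1 : ℂ) ^ κ / (κ.factorial : ℂ) ^ 2) * (z / 2) ^ (2 * (κ : ℤ) - k - 1) =
      reductionCoeffOne (k + 1 - i) κ * (z / 2) ^ (2 * (κ : ℤ) - k - 1) := fun κ _ => by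
    have h1 := Gamma_intCast_add_one ((k : ℤ) - i - κ)
    have h2 := inv_Gamma_intCast_add_one ((k : ℤ) - i - 2 * κ)
    push_cast at h1 h2
    rw [show (k : ℂ) + 1 - i - κ = k - i - κ + 1 by ring,
      show (k : ℂ) + 1 - i - 2 * κ = k - i - 2 * κ + 1 by ring, div_eq_mul_inv (_ ^ 2), h1, h2,
      reductionCoeffOne, Nat.cast_sub (by omega : i ≤ k + 1)]
    push_cast
    rw [show (k : ℤ) + 1 - i - 1 - κ = k - i - κ by ring,
      show (k : ℤ) + 1 - i - 1 - 2 * κ = k - i - 2 * κ by ring]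
    ring
  rw [Finset.sum_congr rfl e, hermiteCoeff]
  ring

theorem prefactorH0_eq {k : ℕ} (hk : 1 ≤ k) (z : ℂ) :
    prefactorH0 k z = 1 / 2 * ∑ i ∈ Finset.range (k + 1), (-1 / 4) ^ i * hermiteCoeff k i *
      ∑ κ ∈ Finset.range (k + 1), reductionCoeffZero (k + 1 - i) κ *
        (z / 2) ^ (2 * (κ : ℤ) - k) := by
  rw [sum_range_eq_sum_range (M := k + 1) (N := (k + 1) / 2 + 1)
    (fun i hi => by rw [hermiteCoeff_eq_zero (by omega), mul_zero, zero_mul])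
    (fun i hi => by rw [hermiteCoeff_eq_zero (by omega), mul_zero, zero_mul]),
    prefactorH0, Finset.mul_sum]
  refine Finset.sum_congr rfl fun i hi => ?_
  have hi' := Finset.mem_range.mp hi
  rw [sum_range_eq_sum_range (M := k + 1) (N := (k - i) / 2 + 1)
    (fun κ hκ => by rw [reductionCoeffZero_eq_zero (by omega), zero_mul])
    (fun κ hκ => by rw [reductionCoeffZero_eq_zero (by omega), zero_mul])]
  have e : ∀ κ ∈ Finset.range ((k - i) / 2 + 1),
      Complex.Gamma (k + 1 - i - κ) * Complex.Gamma (k - i - κ) /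
            Complex.Gamma (k - i - 2 * κ) *
          ((-1 : ℂ) ^ κ / ((κ.factorial : ℂ) * ((κ + 1).factorial : ℂ))) *
          (z / 2) ^ (2 * (κ : ℤ) - k) =
      reductionCoeffZero (k + 1 - i) κ * (z / 2) ^ (2 * (κ : ℤ) - k) := fun κ _ => by
    have h1 := Gamma_intCast_add_one ((k : ℤ) - i - κ)
    have h2 := Gamma_intCast_add_one ((k : ℤ) - 1 - i - κ)
    have h3 := inv_Gamma_intCast_add_one ((k : ℤ) - 1 - i - 2 * κ)
    push_cast at h1 h2 h3
    rw [show (k : ℂ) + 1 - i - κ = k - i - κ + 1 by ring,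
      show (k : ℂ) - i - κ = k - 1 - i - κ + 1 by ring,
      show (k : ℂ) - i - 2 * κ = k - 1 - i - 2 * κ + 1 by ring,
      show (k : ℂ) - 1 - i - κ + 1 + 1 = k - i - κ + 1 by ring,
      div_eq_mul_inv (_ * _) (Complex.Gamma _), h1, h2, h3,
      reductionCoeffZero, Nat.cast_sub (by omega : i ≤ k + 1)]
    push_cast
    rw [show (k : ℤ) + 1 - i - 1 - κ = k - i - κ by ring,
      show (k : ℤ) + 1 - i - 2 - κ = k - 1 - i - κ by ring,
      show (k : ℤ) + 1 - i - 2 - 2 * κ = k - 1 - i - 2 * κ by ring]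
    ring
  rw [Finset.sum_congr rfl e, hermiteCoeff]
  ring

theorem iteratedDeriv_struveH_div_eq_prefactor {k : ℕ} (hk : 1 ≤ k) {z : ℂ} (hz : z ≠ 0) :
    (-1) ^ k * iteratedDeriv k (fun w => struveH 1 w / w) z =
      (k.factorial : ℂ) * (prefactorH1 k z * struveH 1 z - prefactorH0 k z * struveH 0 z +
        2 * ∑ i ∈ Finset.range (k + 1), (-1) ^ i * hermiteCoeff k i *
          (struveS (k + 1 - i) z / (2 * z) ^ (i + 1)) - elementarySum k z) := by
  have hw : z / 2 ≠ 0 := div_ne_zero hz two_ne_zero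
  have hmul : ∀ a b : ℂ, (-1) ^ k * (a * (-1) ^ k * b) = a * b := fun a b => by
    have hs : (-1 : ℂ) ^ k * (-1) ^ k = 1 := by rw [← mul_pow]; simp
    linear_combination a * b * hs
  rw [iteratedDeriv_struveH_div k hz, hmul, prefactorH1_eq hk, prefactorH0_eq hk, Finset.mul_sum,
    Finset.mul_sum, Finset.mul_sum, Finset.mul_sum, Finset.sum_mul, Finset.sum_mul,
    ← Finset.sum_sub_distrib, ← Finset.sum_add_distrib]
  congr 2
  refine Finset.sum_congr rfl fun i hi => ?_
  have hi' := Finset.mem_range.mp hi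
  have key : ∀ s : ℤ, (z / 2) ^ (s - (k + 1 - i : ℕ)) = (z / 2) ^ (s - k - 1) * (z / 2) ^ i :=
    fun s => by
      rw [Nat.cast_sub hi'.le, ← zpow_natCast (z / 2) i, ← zpow_add₀ hw]
      congr 1
      push_cast
      ring
  rw [struveH_eq_reduction (K := k + 1) (by omega) (by omega) hz]
  have e1 : ∀ κ ∈ Finset.range (k + 1), reductionCoeffOne (k + 1 - i) κ *
      (z / 2) ^ (2 * (κ : ℤ) + 1 - (k + 1 - i : ℕ)) = reductionCoeffOne (k + 1 - i) κ *
      (z / 2) ^ (2 * (κ : ℤ) - k - 1) * (z / 2) ^ (i + 1) := fun κ _ => by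
    rw [key, show 2 * (κ : ℤ) + 1 - k - 1 = 2 * (κ : ℤ) - k - 1 + 1 by ring, zpow_add_one₀ hw]
    ring
  have e2 : ∀ κ ∈ Finset.range (k + 1), reductionCoeffZero (k + 1 - i) κ *
      (z / 2) ^ (2 * (κ : ℤ) + 2 - (k + 1 - i : ℕ)) = reductionCoeffZero (k + 1 - i) κ *
      (z / 2) ^ (2 * (κ : ℤ) - k) * (z / 2) ^ (i + 1) := fun κ _ => by
    rw [key, show 2 * (κ : ℤ) + 2 - k - 1 = 2 * (κ : ℤ) - k + 1 by ring, zpow_add_one₀ hw]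
    ring
  have e3 : (2 * z) ^ (i + 1) = 4 ^ (i + 1) * (z / 2) ^ (i + 1) := by
    rw [← mul_pow]
    congr 1
    ring
  have e4 : (-1 / 4 : ℂ) ^ i = (-1) ^ i * 4 / 4 ^ (i + 1) := by
    rw [div_pow, pow_succ]
    field_simp
  rw [Finset.sum_congr rfl e1, Finset.sum_congr rfl e2, ← Finset.sum_mul, ← Finset.sum_mul, e3, e4]
  field_simp
  ring

/-! ### The polynomial prefactors -/

theorem sum_range_add_sum_Icc {a b : ℕ} (h : a ≤ b) (f : ℕ → ℂ) :
    ∑ i ∈ Finset.range (a + 1), f i + ∑ i ∈ Finset.Icc (a + 1) b, f i =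
      ∑ i ∈ Finset.range (b + 1), f i := by
  rw [← Finset.sum_range_add_sum_Ico f (Nat.succ_le_succ h)]
  rfl

theorem eval_C_mul_halfPow (c : ℂ) (n : ℕ) (z : ℂ) :
    (Polynomial.C c * halfPow n).eval z = c * (z / 2) ^ n := by
  simp only [halfPow, Polynomial.eval_mul, Polynomial.eval_C, Polynomial.eval_pow,
    Polynomial.eval_X]
  ring

theorem sigma0Coeff_mul {k n ν : ℕ} (hn : n ≤ k + 1) (hν : ∀ i, n ≤ i →
      hermiteCoeff k i * reductionCoeffZero (k + 1 - i) ν = 0) :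
    sigma0Coeff k n ν * ((-1) ^ (ν + 1) / ((ν.factorial : ℂ) * ((ν + 1).factorial : ℂ))) =
      -(1 / 2 * ∑ i ∈ Finset.range (k + 1), (-1 / 4) ^ i *
        (hermiteCoeff k i * reductionCoeffZero (k + 1 - i) ν)) := by
  rw [sum_range_eq_sum_range (M := k + 1) (N := n)
    (fun i hi => by rw [hν i (hn.trans hi), mul_zero]) (fun i hi => by rw [hν i hi, mul_zero]),
    sigma0Coeff, mul_assoc, ← mul_neg, Finset.sum_mul, ← Finset.sum_neg_distrib]
  congr 1
  refine Finset.sum_congr rfl fun i hi => ?_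
  have hi' := Finset.mem_range.mp hi
  rw [reductionCoeffZero, hermiteCoeff, Nat.cast_sub (by omega : i ≤ k + 1)]
  push_cast
  rw [show (k : ℤ) + 1 - i - 1 - ν = k - ν - i by ring,
    show (k : ℤ) + 1 - i - 2 - ν = k - 1 - ν - i by ring,
    show (k : ℤ) + 1 - i - 2 - 2 * ν = k - 1 - 2 * ν - i by ring, pow_succ]
  ring

theorem sigma1Coeff_mul {k n ν : ℕ} (hn : n ≤ k + 1) (hν : ∀ i, n ≤ i →
      hermiteCoeff k i * reductionCoeffOne (k + 1 - i) ν = 0) :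
    sigma1Coeff k n ν * ((-1) ^ ν / (ν.factorial : ℂ) ^ 2) =
      1 / 2 * ∑ i ∈ Finset.range (k + 1), (-1 / 4) ^ i *
        (hermiteCoeff k i * reductionCoeffOne (k + 1 - i) ν) := by
  rw [sum_range_eq_sum_range (M := k + 1) (N := n)
    (fun i hi => by rw [hν i (hn.trans hi), mul_zero]) (fun i hi => by rw [hν i hi, mul_zero]),
    sigma1Coeff, mul_assoc, Finset.sum_mul]
  congr 1
  refine Finset.sum_congr rfl fun i hi => ?_
  have hi' := Finset.mem_range.mp hi
  rw [reductionCoeffOne, hermiteCoeff, Nat.cast_sub (by omega : i ≤ k + 1)]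
  push_cast
  rw [show (k : ℤ) + 1 - i - 1 - ν = k - ν - i by ring,
    show (k : ℤ) + 1 - i - 1 - 2 * ν = k - 2 * ν - i by ring]
  ring

theorem eval_sigma0 {k : ℕ} (z : ℂ) :
    (sigma0 k).eval z = -((k.factorial : ℂ) * ∑ ν ∈ Finset.range (k + 1),
      1 / 2 * (∑ i ∈ Finset.range (k + 1), (-1 / 4) ^ i *
        (hermiteCoeff k i * reductionCoeffZero (k + 1 - i) ν)) * (z / 2) ^ (2 * ν)) := by
  have hz : ∀ ν i : ℕ, k - 2 * ν ≤ i →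
      hermiteCoeff k i * reductionCoeffZero (k + 1 - i) ν = 0 := fun ν i hi => by
    rw [reductionCoeffZero_eq_zero (by omega), mul_zero]
  rw [sigma0, Polynomial.eval_mul, Polynomial.eval_C, Polynomial.eval_add,
    Polynomial.eval_finsetSum, Polynomial.eval_finsetSum, ← mul_neg, ← Finset.sum_neg_distrib,
    sum_range_eq_sum_range (M := k + 1) (N := k / 2 + 1)
      (f := fun ν => -(1 / 2 * (∑ i ∈ Finset.range (k + 1), (-1 / 4) ^ i *
        (hermiteCoeff k i * reductionCoeffZero (k + 1 - i) ν)) * (z / 2) ^ (2 * ν)))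
      (fun ν hν => by
        rw [Finset.sum_eq_zero fun i _ => by rw [hz ν i (by omega), mul_zero]]
        ring)
      (fun ν hν => by
        rw [Finset.sum_eq_zero fun i _ => by rw [hz ν i (by omega), mul_zero]]
        ring),
    ← sum_range_add_sum_Icc (Nat.div_le_self (k / 2) 2)]
  congr 2
  · refine Finset.sum_congr rfl fun ν _ => ?_
    rw [eval_C_mul_halfPow, sigma0Coeff_mul (by omega)
      (fun i hi => by rw [hermiteCoeff_eq_zero (by omega), zero_mul]), neg_mul]
  · refine Finset.sum_congr rfl fun ν _ => ?_
    rw [eval_C_mul_halfPow, sigma0Coeff_mul (by omega) (hz ν), neg_mul]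

theorem eval_sigma1 {k : ℕ} (z : ℂ) :
    (sigma1 k).eval z = (k.factorial : ℂ) * ∑ ν ∈ Finset.range (k + 1),
      1 / 2 * (∑ i ∈ Finset.range (k + 1), (-1 / 4) ^ i *
        (hermiteCoeff k i * reductionCoeffOne (k + 1 - i) ν)) * (z / 2) ^ (2 * ν) := by
  have hz : ∀ ν i : ℕ, k + 1 - 2 * ν ≤ i →
      hermiteCoeff k i * reductionCoeffOne (k + 1 - i) ν = 0 := fun ν i hi => by
    rw [reductionCoeffOne_eq_zero (by omega), mul_zero]
  rw [sigma1, Polynomial.eval_mul, Polynomial.eval_C, Polynomial.eval_add,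
    Polynomial.eval_finsetSum, Polynomial.eval_finsetSum,
    sum_range_eq_sum_range (M := k + 1) (N := (k + 1) / 2 + 1)
      (f := fun ν => 1 / 2 * (∑ i ∈ Finset.range (k + 1), (-1 / 4) ^ i *
        (hermiteCoeff k i * reductionCoeffOne (k + 1 - i) ν)) * (z / 2) ^ (2 * ν))
      (fun ν hν => by
        rw [Finset.sum_eq_zero fun i _ => by rw [hz ν i (by omega), mul_zero]]
        ring)
      (fun ν hν => by
        rw [Finset.sum_eq_zero fun i _ => by rw [hz ν i (by omega), mul_zero]]
        ring),
    ← sum_range_add_sum_Icc (show (k / 2 + 1) / 2 ≤ (k + 1) / 2 by omega), add_comm 1]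
  congr 2
  · refine Finset.sum_congr rfl fun ν _ => ?_
    rw [eval_C_mul_halfPow, sigma1Coeff_mul (by omega)
      (fun i hi => by rw [hermiteCoeff_eq_zero (by omega), zero_mul])]
  · refine Finset.sum_congr rfl fun ν hν => ?_
    have hν' := Finset.mem_Icc.mp hν
    rw [eval_C_mul_halfPow, sigma1Coeff_mul (by omega) (fun i hi => hz ν i (by omega))]

theorem eval_sigma0_mul {k : ℕ} (hk : 1 ≤ k) {z : ℂ} (hz : z ≠ 0) :
    (sigma0 k).eval z * (2 / z) ^ k = -((k.factorial : ℂ) * prefactorH0 k z) := by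
  have hw : z / 2 ≠ 0 := div_ne_zero hz two_ne_zero
  rw [eval_sigma0, prefactorH0_eq hk, neg_mul, mul_assoc]
  congr 2
  simp only [Finset.mul_sum, Finset.sum_mul]
  rw [Finset.sum_comm]
  refine Finset.sum_congr rfl fun i _ => Finset.sum_congr rfl fun κ _ => ?_
  rw [zpow_sub₀ hw, zpow_natCast, ← inv_div z 2, inv_pow]
  norm_cast
  ring

theorem eval_sigma1_mul {k : ℕ} (hk : 1 ≤ k) {z : ℂ} (hz : z ≠ 0) :
    (sigma1 k).eval z * (2 / z) ^ (k + 1) = (k.factorial : ℂ) * prefactorH1 k z := by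
  have hw : z / 2 ≠ 0 := div_ne_zero hz two_ne_zero
  rw [eval_sigma1, prefactorH1_eq hk, mul_assoc]
  congr 1
  simp only [Finset.mul_sum, Finset.sum_mul]
  rw [Finset.sum_comm]
  refine Finset.sum_congr rfl fun i _ => Finset.sum_congr rfl fun κ _ => ?_
  rw [show 2 * (κ : ℤ) - k - 1 = (2 * κ : ℕ) - (k + 1 : ℕ) by push_cast; ring, zpow_sub₀ hw,
    zpow_natCast, zpow_natCast, ← inv_div z 2, inv_pow]
  ring

/-! ### The part without Struve functions -/

/-- `π` times the coefficient of `(z / 2) ^ (2 ν + 1 - n)` in `struveS n z`. -/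
noncomputable def struveSCoeff (n ν : ℕ) : ℂ :=
  intFact ((n : ℤ) - 1 - ν) / (ν.factorial : ℂ) * ∑ κ ∈ Finset.range ν,
    (-1) ^ κ / (κ.factorial : ℂ) * ((Real.sqrt Real.pi : ℂ) * intFact ((n : ℤ) - 1 - κ) *
      recipFact ((n : ℤ) - 1 - ν - κ) / Complex.Gamma (ν + 3 / 2 - κ))

theorem struveSCoeff_eq_zero {n ν : ℕ} (h : n ≤ ν) : struveSCoeff n ν = 0 := by
  rw [struveSCoeff, intFact_of_neg (by omega), zero_div, zero_mul]

theorem struveS_eq_sum_struveSCoeff (n : ℕ) {z : ℂ} (hz : z ≠ 0) :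
    struveS n z = (Real.pi : ℂ)⁻¹ * ∑ ν ∈ Finset.Icc 1 (n - 1),
      struveSCoeff n ν * (z / 2) ^ (2 * (ν : ℤ) + 1 - n) := by
  have hw : z / 2 ≠ 0 := div_ne_zero hz two_ne_zero
  have hpi := sqrt_pi_ne_zero
  have h1 : ∀ l ∈ Finset.range (n - 1), struveInhom (n - 1 - l) z * lommelC n z l =
      ∑ κ ∈ Finset.range (l + 1), struveInhom (n - 1 - l) z *
        (lommelCoeff n l κ * (z / 2) ^ (2 * (κ : ℤ) - l)) := fun l hl => by
    rw [lommelC_eq_sum (by have := Finset.mem_range.mp hl; omega) hz, Finset.mul_sum]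
  have h2 : ∀ ν ∈ Finset.Icc 1 (n - 1), struveSCoeff n ν * (z / 2) ^ (2 * (ν : ℤ) + 1 - n) =
      ∑ κ ∈ Finset.range ν, intFact ((n : ℤ) - 1 - ν) / (ν.factorial : ℂ) *
      ((-1) ^ κ / (κ.factorial : ℂ) * ((Real.sqrt Real.pi : ℂ) * intFact ((n : ℤ) - 1 - κ) *
      recipFact ((n : ℤ) - 1 - ν - κ) / Complex.Gamma (ν + 3 / 2 - κ))) *
      (z / 2) ^ (2 * (ν : ℤ) + 1 - n) := fun ν _ => by
    rw [struveSCoeff, Finset.mul_sum, Finset.sum_mul]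
  rw [struveS_eq, Finset.sum_congr rfl h1, Finset.sum_congr rfl h2, Finset.sum_sigma',
    Finset.sum_sigma', Finset.mul_sum]
  -- in the term with indices `l`, `κ` the power of `z / 2` is `n - 1 - 2 (l - κ)`
  refine Finset.sum_bij' (fun x _ => ⟨n - 1 - x.1 + x.2, x.2⟩)
    (fun x _ => ⟨n - 1 - x.1 + x.2, x.2⟩) ?_ ?_ ?_ ?_ ?_
  · rintro ⟨l, κ⟩ h
    simp only [Finset.mem_sigma, Finset.mem_range, Finset.mem_Icc] at h ⊢
    omega
  · rintro ⟨ν, κ⟩ h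
    simp only [Finset.mem_sigma, Finset.mem_range, Finset.mem_Icc] at h ⊢
    omega
  · rintro ⟨l, κ⟩ h
    simp only [Finset.mem_sigma, Finset.mem_range] at h
    simp only [Sigma.mk.injEq, heq_eq_eq, and_true]
    omega
  · rintro ⟨ν, κ⟩ h
    simp only [Finset.mem_sigma, Finset.mem_range, Finset.mem_Icc] at h
    simp only [Sigma.mk.injEq, heq_eq_eq, and_true]
    omega
  · rintro ⟨l, κ⟩ h
    simp only [Finset.mem_sigma, Finset.mem_range] at h
    obtain ⟨m, rfl⟩ : ∃ m, n = m + (l + 1) := ⟨n - (l + 1), by omega⟩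
    simp only [show m + (l + 1) - 1 - l = m by omega]
    rw [struveInhom, lommelCoeff, ← zpow_natCast (z / 2) m, ← sqrt_pi_sq]
    push_cast
    rw [show (m : ℤ) + (l + 1) - 1 - l + κ = (m + κ : ℕ) by push_cast; ring, recipFact_natCast,
      show (m : ℤ) + (l + 1) - 1 - (m + κ) = l - κ by ring,
      show (l : ℤ) - κ - κ = l - 2 * κ by ring,
      show (m : ℂ) + κ + 3 / 2 - κ = m + 3 / 2 by ring,
      show 2 * ((m : ℤ) + κ) + 1 - (m + (l + 1)) = m + (2 * κ - l) by ring, zpow_add₀ hw]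
    simp only [div_eq_mul_inv, mul_inv]
    field_simp

/-- If `r ≤ ν - 1`, then the alternating sum in `struveSCoeff` is not truncated, and has a
closed form. -/
theorem struveSCoeff_eq {r ν : ℕ} (h : r < ν) :
    struveSCoeff (ν + r + 1) ν = Complex.Gamma (r + 1 / 2) / Complex.Gamma (ν + 3 / 2) := by
  have hν : (ν.factorial : ℂ) ≠ 0 := by exact_mod_cast ν.factorial_ne_zero
  have hpi := sqrt_pi_ne_zero
  have key := sum_choose_factorial_Gamma r ν (ν + 3 / 2)
  rw [show (ν : ℂ) + 2 - (ν + 3 / 2) = 1 / 2 by ring, ascPochhammer_half] at key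
  have hG : Complex.Gamma (r + 1 / 2) / Complex.Gamma (ν + 3 / 2) =
      (Real.sqrt Real.pi : ℂ) / (ν.factorial : ℂ) * ((ν.factorial : ℂ) *
        (Complex.Gamma (r + 1 / 2) / (Real.sqrt Real.pi : ℂ)) *
          (Complex.Gamma (ν + 3 / 2))⁻¹) := by
    field_simp
  rw [hG, ← key, struveSCoeff, sum_range_eq_sum_range (M := ν) (N := r + 1)
    (fun κ hκ => by rw [recipFact_of_neg (by push_cast; omega), mul_zero, zero_div, mul_zero])
    (fun κ hκ => by rw [recipFact_of_neg (by push_cast; omega), mul_zero, zero_div, mul_zero]),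
    Finset.mul_sum, Finset.mul_sum]
  refine Finset.sum_congr rfl fun κ hκ => ?_
  have hκ' : κ ≤ r := Nat.lt_succ_iff.mp (Finset.mem_range.mp hκ)
  rw [show ((ν + r + 1 : ℕ) : ℤ) - 1 - ν = (r : ℕ) by push_cast; ring,
    show ((ν + r + 1 : ℕ) : ℤ) - 1 - κ = (ν + (r - κ) : ℕ) by omega,
    show ((r : ℕ) : ℤ) - κ = (r - κ : ℕ) by omega, intFact_natCast, intFact_natCast,
    recipFact_natCast, Nat.cast_choose ℂ hκ']
  simp only [div_eq_mul_inv, mul_inv]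
  ring

/-- `2 π` times the coefficient of `(z / 2) ^ (2 ν - 1 - k)` in the contribution of the functions
`struveS` to the `k`-th derivative, up to the factor `(-1) ^ k * k!`. -/
noncomputable def reductionCoeffRest (k ν : ℕ) : ℂ :=
  ∑ i ∈ Finset.range (k + 1), (-1 / 4) ^ i * (hermiteCoeff k i * struveSCoeff (k + 1 - i) ν)

theorem sum_struveS_eq (k : ℕ) {z : ℂ} (hz : z ≠ 0) :
    2 * ∑ i ∈ Finset.range (k + 1), (-1) ^ i * hermiteCoeff k i *
        (struveS (k + 1 - i) z / (2 * z) ^ (i + 1)) =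
      ∑ ν ∈ Finset.Icc 1 k, 1 / (2 * (Real.pi : ℂ)) * reductionCoeffRest k ν *
        (z / 2) ^ (2 * (ν : ℤ) - 1 - k) := by
  have hw : z / 2 ≠ 0 := div_ne_zero hz two_ne_zero
  simp only [reductionCoeffRest, Finset.mul_sum, Finset.sum_mul]
  rw [Finset.sum_comm]
  refine Finset.sum_congr rfl fun i hi => ?_
  have hi' := Finset.mem_range.mp hi
  have hext : ∑ ν ∈ Finset.Icc 1 (k + 1 - i - 1), struveSCoeff (k + 1 - i) ν *
      (z / 2) ^ (2 * (ν : ℤ) + 1 - (k + 1 - i : ℕ)) = ∑ ν ∈ Finset.Icc 1 k,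
      struveSCoeff (k + 1 - i) ν * (z / 2) ^ (2 * (ν : ℤ) + 1 - (k + 1 - i : ℕ)) := by
    refine Finset.sum_subset (Finset.Icc_subset_Icc_right (by omega)) fun ν hν hν' => ?_
    rw [Finset.mem_Icc] at hν hν'
    rw [struveSCoeff_eq_zero (by omega), zero_mul]
  rw [struveS_eq_sum_struveSCoeff _ hz, hext, Finset.mul_sum, Finset.sum_div, Finset.mul_sum,
    Finset.mul_sum]
  refine Finset.sum_congr rfl fun ν _ => ?_
  have e3 : (2 * z) ^ (i + 1) = 4 ^ (i + 1) * (z / 2) ^ (i + 1) := by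
    rw [← mul_pow]
    congr 1
    ring
  have e4 : (-1 / 4 : ℂ) ^ i = (-1) ^ i * 4 / 4 ^ (i + 1) := by
    rw [div_pow, pow_succ]
    field_simp
  have e5 : (z / 2) ^ (2 * (ν : ℤ) + 1 - (k + 1 - i : ℕ)) =
      (z / 2) ^ (2 * (ν : ℤ) - 1 - k) * (z / 2) ^ (i + 1) := by
    rw [← zpow_natCast (z / 2) (i + 1), ← zpow_add₀ hw, Nat.cast_sub hi'.le]
    congr 1
    push_cast
    ring
  rw [e3, e4, e5]
  field_simp
  ring

/-- The elementary part cancels the highest powers of `z` in the contribution of `struveS`. -/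
theorem reductionCoeffRest_eq_elementaryCoeff {k j : ℕ} (h : 2 * j < k) :
    1 / (2 * (Real.pi : ℂ)) * reductionCoeffRest k (k - j) = elementaryCoeff k j := by
  rw [reductionCoeffRest, sum_range_eq_sum_range (M := k + 1) (N := j + 1)
    (fun i hi => by rw [struveSCoeff_eq_zero (by omega), mul_zero, mul_zero])
    (fun i hi => by rw [struveSCoeff_eq_zero (by omega), mul_zero, mul_zero]),
    elementaryCoeff, gaussPartial, Finset.mul_sum, Finset.mul_sum, Finset.mul_sum]
  refine Finset.sum_congr rfl fun i hi => ?_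
  have hi' : i ≤ j := Nat.lt_succ_iff.mp (Finset.mem_range.mp hi)
  obtain ⟨r, rfl⟩ := Nat.exists_eq_add_of_le hi'
  have hr := inv_Gamma_half_sub r
  rw [show k + 1 - i = k - (i + r) + r + 1 by omega, struveSCoeff_eq (by omega),
    show (1 / 2 - ((i + r : ℕ) : ℂ) + i) = 1 / 2 - r by push_cast; ring, hr,
    Nat.cast_sub (by omega : i + r ≤ k),
    show (k : ℂ) - ((i + r : ℕ) : ℂ) + 3 / 2 = k + 3 / 2 - ((i + r : ℕ) : ℂ) by ring, pow_add,
    show (-1 / 4 : ℂ) ^ i = (-1) ^ i * (1 / 4) ^ i by rw [← mul_pow]; norm_num]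
  have hs : (-1 : ℂ) ^ r * (-1) ^ r = 1 := by
    rw [← mul_pow]
    simp
  simp only [div_eq_mul_inv, mul_inv]
  linear_combination (-(1 : ℂ) * 2⁻¹ * (Real.pi : ℂ)⁻¹ * (-1) ^ i * (1 * 4⁻¹) ^ i *
    hermiteCoeff k i * Complex.Gamma (r + 1 * 2⁻¹) *
    (Complex.Gamma (k + 3 * 2⁻¹ - ((i + r : ℕ) : ℂ)))⁻¹) * hs

/-- After cancellation only the terms with `ν ≤ k / 2` remain: for these, the coefficient of the
elementary part is zero by Gauss's theorem. -/
theorem sum_struveS_sub_elementarySum (k : ℕ) {z : ℂ} (hz : z ≠ 0) :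
    2 * ∑ i ∈ Finset.range (k + 1), (-1) ^ i * hermiteCoeff k i *
        (struveS (k + 1 - i) z / (2 * z) ^ (i + 1)) - elementarySum k z =
      ∑ ν ∈ Finset.Icc 1 (k / 2), 1 / (2 * (Real.pi : ℂ)) * reductionCoeffRest k ν *
        (z / 2) ^ (2 * (ν : ℤ) - 1 - k) := by
  have hE : elementarySum k z = ∑ ν ∈ Finset.Icc 1 k, elementaryCoeff k (k - ν) *
      (z / 2) ^ (2 * (ν : ℤ) - 1 - k) := by
    refine Finset.sum_bij' (fun j _ => k - j) (fun ν _ => k - ν) ?_ ?_ ?_ ?_ ?_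
    · intro j hj
      simp only [Finset.mem_range, Finset.mem_Icc] at hj ⊢
      omega
    · intro ν hν
      simp only [Finset.mem_range, Finset.mem_Icc] at hν ⊢
      omega
    · intro j hj
      simp only [Finset.mem_range] at hj
      omega
    · intro ν hν
      simp only [Finset.mem_Icc] at hν
      omega
    · intro j hj
      simp only [Finset.mem_range] at hj
      rw [show k - (k - j) = j by omega, Nat.cast_sub hj.le]
      congr 2
      ring
  rw [sum_struveS_eq k hz, hE, ← Finset.sum_sub_distrib]
  symm
  refine (Finset.sum_subset_zero_on_sdiff (Finset.Icc_subset_Icc_right (Nat.div_le_self k 2))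
    (fun ν hν => ?_) (fun ν hν => ?_))
  · simp only [Finset.mem_sdiff, Finset.mem_Icc] at hν
    have := reductionCoeffRest_eq_elementaryCoeff (k := k) (j := k - ν) (by omega)
    rw [show k - (k - ν) = ν by omega] at this
    rw [this, sub_self]
  · rw [Finset.mem_Icc] at hν
    rw [elementaryCoeff_eq_zero (by omega) (by omega), zero_mul, sub_zero]

theorem frakC_div_factorial {k a ν : ℕ} (ha : a ≤ k) :
    frakC k a ν / (ν.factorial : ℂ) = ∑ j ∈ Finset.range (a + 1),
      (-1 / 4) ^ j * (hermiteCoeff k j * struveSCoeff (k + 1 - j) ν) := by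
  rw [frakC, Finset.sum_div]
  refine Finset.sum_congr rfl fun j hj => ?_
  have hj' := Finset.mem_range.mp hj
  rw [struveSCoeff, hermiteCoeff, Nat.cast_sub (by omega : j ≤ k + 1)]
  push_cast
  rw [show (k : ℤ) + 1 - j - 1 - ν = k - ν - j by ring]
  have e : ∀ κ : ℕ, (k : ℤ) + 1 - j - 1 - κ = k - j - κ := fun κ => by ring
  simp only [e]
  simp only [div_eq_mul_inv]
  ring

theorem frakC_div_factorial_eq_rest {k ν : ℕ} :
    frakC k ((k + 1) / 2) ν / (ν.factorial : ℂ) = reductionCoeffRest k ν := by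
  rcases Nat.eq_zero_or_pos k with rfl | hk
  · exact frakC_div_factorial le_rfl
  rw [frakC_div_factorial (by omega), reductionCoeffRest]
  exact sum_range_eq_sum_range
    (fun i hi => by rw [hermiteCoeff_eq_zero (by omega), zero_mul, mul_zero])
    (fun i hi => by rw [hermiteCoeff_eq_zero (by omega), zero_mul, mul_zero])

/-- For large `ν` the sum over `i` in `sigma2` continues the one in `frakC`, with the inner sums in
closed form. -/
theorem frakC_div_factorial_add_eq_rest {k ν : ℕ} (h1 : 1 + (k / 2 + 1) / 2 ≤ ν)
    (h2 : ν ≤ (k + 1) / 2) :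
    frakC k (k + 1 - 2 * ν) ν / (ν.factorial : ℂ) +
      ∑ i ∈ Finset.Icc (k + 2 - 2 * ν) ((k + 1) / 2),
        (-1 / 4 : ℂ) ^ i / (i.factorial : ℂ) * recipFact ((k : ℤ) - 2 * i) *
          (Complex.Gamma (k + 1 / 2 - ν - i) / Complex.Gamma (ν + 3 / 2)) =
      reductionCoeffRest k ν := by
  rw [← frakC_div_factorial_eq_rest, frakC_div_factorial (by omega),
    frakC_div_factorial (by omega),
    ← sum_range_add_sum_Icc (show k + 1 - 2 * ν ≤ (k + 1) / 2 by omega),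
    show k + 1 - 2 * ν + 1 = k + 2 - 2 * ν by omega]
  congr 1
  refine Finset.sum_congr rfl fun i hi => ?_
  rw [Finset.mem_Icc] at hi
  rcases Nat.lt_or_ge k (2 * i) with h | h
  · rw [recipFact_of_neg (by omega), hermiteCoeff_eq_zero h]
    ring
  · obtain ⟨r, rfl⟩ : ∃ r, k = ν + r + i := ⟨k - ν - i, by omega⟩
    rw [show ν + r + i + 1 - i = ν + r + 1 by omega, struveSCoeff_eq (by omega), hermiteCoeff,
      show ((ν + r + i : ℕ) : ℂ) + 1 / 2 - ν - i = r + 1 / 2 by push_cast; ring]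
    ring

/-- The first term of `sigma2` cancels its term with `ν = (k + 1) / 2` for odd `k`. -/
theorem delta_term_eq (j : ℕ) :
    (-1 / 4 : ℂ) ^ (j + 1) / (Complex.Gamma (j + 3 / 2) * Complex.Gamma ((j + 1 : ℕ) + 3 / 2)) =
      -(1 / (2 * (Real.pi : ℂ)) * reductionCoeffRest (2 * j + 1) (j + 1)) := by
  have h := reductionCoeffRest_eq_elementaryCoeff (k := 2 * j + 1) (j := j) (by omega)
  rw [show 2 * j + 1 - j = j + 1 by omega] at h
  rw [h, elementaryCoeff, gaussPartial_odd,
    show ((2 * j + 1 : ℕ) : ℂ) + 3 / 2 - j = (j + 1 : ℕ) + 3 / 2 by push_cast; ring,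
    show (-1 / 4 : ℂ) ^ (j + 1) = -((-1) ^ j * (1 / 4) ^ (j + 1)) by
      rw [neg_div, neg_eq_neg_one_mul, mul_pow]; ring,
    show (1 / 2 : ℂ) ^ (2 * j + 1) = 2 * (1 / 4) ^ (j + 1) by
      rw [pow_succ, pow_mul, pow_succ]; norm_num; ring]
  simp only [div_eq_mul_inv, mul_inv]
  ring

theorem eval_sigma2 (k : ℕ) (z : ℂ) :
    (sigma2 k).eval z = (k.factorial : ℂ) * ∑ ν ∈ Finset.Icc 1 (k / 2),
      1 / (2 * (Real.pi : ℂ)) * reductionCoeffRest k ν * (z / 2) ^ (2 * ν - 2) := by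
  have h1 : ∀ ν ∈ Finset.Icc 1 ((k / 2 + 1) / 2),
      (Polynomial.C (frakC k ((k + 1) / 2) ν / (ν.factorial : ℂ)) * halfPow (2 * ν - 2)).eval z =
      reductionCoeffRest k ν * (z / 2) ^ (2 * ν - 2) := fun ν _ => by
    rw [eval_C_mul_halfPow, frakC_div_factorial_eq_rest]
  have h2 : ∀ ν ∈ Finset.Icc (1 + (k / 2 + 1) / 2) ((k + 1) / 2),
      (Polynomial.C (frakC k (k + 1 - 2 * ν) ν / (ν.factorial : ℂ) +
          ∑ i ∈ Finset.Icc (k + 2 - 2 * ν) ((k + 1) / 2),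
            (-1 / 4 : ℂ) ^ i / (i.factorial : ℂ) * recipFact ((k : ℤ) - 2 * i) *
              (Complex.Gamma (k + 1 / 2 - ν - i) / Complex.Gamma (ν + 3 / 2))) *
          halfPow (2 * ν - 2)).eval z =
      reductionCoeffRest k ν * (z / 2) ^ (2 * ν - 2) := fun ν hν => by
    rw [Finset.mem_Icc] at hν
    rw [eval_C_mul_halfPow, frakC_div_factorial_add_eq_rest hν.1 hν.2]
  have h3 : ∑ ν ∈ Finset.Icc 1 ((k / 2 + 1) / 2),
        reductionCoeffRest k ν * (z / 2) ^ (2 * ν - 2) +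
      ∑ ν ∈ Finset.Icc (1 + (k / 2 + 1) / 2) ((k + 1) / 2),
        reductionCoeffRest k ν * (z / 2) ^ (2 * ν - 2) =
      ∑ ν ∈ Finset.Icc 1 ((k + 1) / 2), reductionCoeffRest k ν * (z / 2) ^ (2 * ν - 2) := by
    rw [add_comm 1 ((k / 2 + 1) / 2)]
    exact Finset.sum_Ico_consecutive (fun ν => reductionCoeffRest k ν * (z / 2) ^ (2 * ν - 2))
      (by omega : 1 ≤ (k / 2 + 1) / 2 + 1) (by omega : (k / 2 + 1) / 2 + 1 ≤ (k + 1) / 2 + 1)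
  rw [sigma2, Polynomial.eval_mul, Polynomial.eval_C, Polynomial.eval_add, Polynomial.eval_add,
    eval_C_mul_halfPow, Polynomial.eval_mul, Polynomial.eval_mul, Polynomial.eval_C,
    Polynomial.eval_finsetSum, Polynomial.eval_finsetSum, Finset.sum_congr rfl h1,
    Finset.sum_congr rfl h2, add_assoc, ← mul_add, h3]
  simp only [mul_assoc (1 / (2 * (Real.pi : ℂ))), ← Finset.mul_sum]
  congr 1
  rcases Nat.even_or_odd' k with ⟨j, rfl | rfl⟩
  · rw [show (2 * j + 1) / 2 = 2 * j / 2 by omega, if_neg (by omega)]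
    ring
  · have hd := delta_term_eq j
    rw [show (2 * j + 1 + 1) / 2 = j + 1 by omega, show (2 * j + 1) / 2 = j by omega,
      if_pos (by omega), mul_one, hd,
      Finset.sum_Icc_succ_top (by omega : 1 ≤ j + 1),
      show 2 * (j + 1) - 2 = 2 * j + 1 - 1 by omega]
    ring

theorem eval_sigma2_mul (k : ℕ) {z : ℂ} (hz : z ≠ 0) :
    (sigma2 k).eval z * (2 / z) ^ ((k : ℤ) - 1) = (k.factorial : ℂ) *
      (2 * ∑ i ∈ Finset.range (k + 1), (-1) ^ i * hermiteCoeff k i *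
        (struveS (k + 1 - i) z / (2 * z) ^ (i + 1)) - elementarySum k z) := by
  have hw : z / 2 ≠ 0 := div_ne_zero hz two_ne_zero
  rw [sum_struveS_sub_elementarySum k hz, eval_sigma2, mul_assoc, Finset.sum_mul]
  congr 1
  refine Finset.sum_congr rfl fun ν hν => ?_
  rw [Finset.mem_Icc] at hν
  rw [mul_assoc, ← inv_div z 2, inv_zpow', ← zpow_natCast (z / 2), ← zpow_add₀ hw,
    Nat.cast_sub (by omega : 2 ≤ 2 * ν)]
  congr 2
  push_cast
  ring

end Struve

theorem mainTheorem4 :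
    -- the function is analytic away from the origin, so that all derivatives below exist
    (∀ z : ℂ, z ≠ 0 → AnalyticAt ℂ (fun w : ℂ => struveH 1 w / w) z) ∧
    -- the derivative as a sum of Struve functions of higher order and an elementary part
    (∀ k : ℕ, 1 ≤ k → ∀ z : ℂ, z ≠ 0 →
      iteratedDeriv k (fun w : ℂ => struveH 1 w / w) z =
        (k.factorial : ℂ) * (-1) ^ k *
          (2 * ∑ i ∈ Finset.range (k / 2 + 1),
              (-1 : ℂ) ^ i / ((i.factorial : ℂ) * ((k - 2 * i).factorial : ℂ)) *
                (struveH (k + 1 - i) z / (2 * z) ^ (i + 1))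
            - elementaryPart k z)) ∧
    -- the elementary part is a polynomial in z
    (∀ k : ℕ, 1 ≤ k → ∃ p : Polynomial ℂ, ∀ z : ℂ, z ≠ 0 → elementaryPart k z = p.eval z) ∧
    -- the reduction to orders zero and one
    (∀ k : ℕ, 1 ≤ k → ∀ z : ℂ, z ≠ 0 →
      (-1) ^ k / (k.factorial : ℂ) * iteratedDeriv k (fun w : ℂ => struveH 1 w / w) z =
        prefactorH1 k z * struveH 1 z - prefactorH0 k z * struveH 0 z
          + 2 * ∑ i ∈ Finset.range ((k + 1) / 2 + 1),
              (-1 : ℂ) ^ i / (i.factorial : ℂ) * recipFact ((k : ℤ) - 2 * i) *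
                (struveS (k + 1 - i) z / (2 * z) ^ (i + 1))
          - elementaryPart k z) ∧
    -- the final form with the polynomials σ₀, σ₁, σ₂
    (∀ (k : ℕ) (z : ℂ), z ≠ 0 →
      (-1) ^ k * iteratedDeriv k (fun w : ℂ => struveH 1 w / w) z =
        struveH 0 z * (sigma0 k).eval z * (2 / z) ^ k
          + struveH 1 z * (sigma1 k).eval z * (2 / z) ^ (k + 1)
          + (sigma2 k).eval z * (2 / z) ^ ((k : ℤ) - 1)) := by
  refine ⟨fun z hz => Struve.analyticAt_struveH_div 1 hz, fun k hk z hz => ?_, fun k hk => ?_,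
    fun k hk z hz => ?_, fun k z hz => ?_⟩
  · rw [Struve.iteratedDeriv_struveH_div k hz, Struve.elementaryPart_eq_elementarySum hk,
      Struve.sum_range_eq_sum_range (M := k + 1) (N := k / 2 + 1)
        (fun i hi => by rw [Struve.hermiteCoeff_eq_zero (by omega), mul_zero, zero_mul])
        (fun i hi => by rw [Struve.hermiteCoeff_eq_zero (by omega), mul_zero, zero_mul])]
    congr 3
    refine Finset.sum_congr rfl fun i hi => ?_
    have hi' := Finset.mem_range.mp hi
    rw [Struve.hermiteCoeff_eq (by omega), mul_one_div]
  · obtain ⟨p, hp⟩ := Struve.exists_polynomial_elementaryPart hk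
    exact ⟨p, fun z _ => hp z⟩
  · have hfact : (k.factorial : ℂ) ≠ 0 := by exact_mod_cast k.factorial_ne_zero
    rw [div_mul_eq_mul_div, Struve.iteratedDeriv_struveH_div_eq_prefactor hk hz,
      mul_div_cancel_left₀ _ hfact, Struve.elementaryPart_eq_elementarySum hk,
      Struve.sum_range_eq_sum_range (M := k + 1) (N := (k + 1) / 2 + 1)
        (fun i hi => by rw [Struve.hermiteCoeff_eq_zero (by omega), mul_zero, zero_mul])
        (fun i hi => by rw [Struve.hermiteCoeff_eq_zero (by omega), mul_zero, zero_mul])]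
    congr 3
    refine Finset.sum_congr rfl fun i _ => ?_
    rw [Struve.hermiteCoeff]
    ring
  · have h2 := Struve.eval_sigma2_mul k hz
    rcases Nat.eq_zero_or_pos k with rfl | hk
    · have h0 : (sigma0 0).eval z = 0 := by
        simp [Struve.eval_sigma0, Struve.reductionCoeffZero_eq_zero]
      have h1 : (sigma1 0).eval z = 1 / 2 := by
        simp [Struve.eval_sigma1, Struve.reductionCoeffOne, Struve.hermiteCoeff, intFact,
          recipFact]
      have h3 : (sigma2 0).eval z = 0 := by simp [Struve.eval_sigma2]
      rw [h0, h1, h3, iteratedDeriv_zero, pow_zero, one_mul, mul_zero, zero_mul, zero_mul,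
        zero_add, add_zero, zero_add, pow_one]
      ring
    · rw [Struve.iteratedDeriv_struveH_div_eq_prefactor hk hz, mul_assoc, mul_assoc,
        Struve.eval_sigma0_mul hk hz, Struve.eval_sigma1_mul hk hz, h2]
      ring
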